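/- Setting. Fix $\beta>1$, $T>0$ and points $0\le b_1<\dots<b_k<1$ of the torus $\mathbb T=[0,1)$; put $b_{k+1}=b_1+1$. Let $\mathbb T_N=\{1,\dots,N\}$ be the discrete torus. Consider the Markov process $(\eta_t)_{t\ge 0}$ on $\{0,1\}^{\mathbb T_N}$ with generator $N^2\mathcal L_N$, where $$\mathcal L_Nf(\eta)=\sum_{x\in\mathbb T_N}\xi^N_{x,x+1}\,[f(\eta^{x,x+1})-f(\eta)],$$ $\eta^{x,x+1}$ is $\eta$ with the values at $x$ and $x+1$ exchanged, $\xi^N_{x,x+1}=N^{-\beta}$ if $(\frac xN,\frac{x+1}N]$ contains (modulo 1) one of the points $b_i$, and $\xi^N_{x,x+1}=1$ otherwise. Let $\gamma:\mathbb T\to[0,1]$ be continuous, and let the initial laws $\mu_N$ be associated to $\gamma$: for every $H\in C(\mathbb T)$ and $\delta>0$, $\mu_N\{|\frac1N\sum_x H(\frac xN)\eta(x)-\int_{\mathbb T} H\gamma\,du|>\delta\}\to0$. Let $\mathcal M$ be the space of positive measures on $\mathbb T$ of total mass at most $1$ with the weak topology, let $\pi^N_t=\frac1N\sum_x\eta_t(x)\delta_{x/N}$,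 and let $\mathbb Q_N$ be the law of $(\pi^N_t)_{0\le t\le T}$ on $D([0,T],\mathcal M)$ with the Skorohod topology. Let $\mathbb Q_*$ be a limit point, that is, a weak limit of a subsequence, of $(\mathbb Q_N)$. Let $\mathcal C$ be the set of $H\in C^{0,1}([0,T]\times\mathbb T)$ (continuous, with $\partial_uH$ existing and continuous) whose closed support is contained in $[0,T]\times(\mathbb T\setminus\{b_1,\dots,b_k\})$. For $\alpha\in(0,1)$ let $\nu_\alpha$ be the Bernoulli product measure of density $\alpha$ on $\{0,1\}^{\mathbb T_N}$, and call $K_0$ an entropy constant for $\alpha$ if the relative entropy satisfies $H_N(\mu|\nu_\alpha)\le K_0N$ for all $N\ge1$ and all probability measures $\mu$ on $\{0,1\}^{\mathbb T_N}$. Claim. $\mathbb Q_*$ is concentrated on paths $\pi_t(du)=\rho(t,u)\,du$, $0\le t\le T$, with $\rho=\rho^\pi:[0,T]\times\mathbb T\to[0,1]$ measurable, such that: (i) there is $\partial_u\rho\in L^2([0,T]\times\mathbb T)$ with $$\int_0^T\!\!\int_{\mathbb T}\partial_uH\,\rho\,du\,ds=-\int_0^T\!\!\int_{\mathbb T}H\,\partial_u\rho\,du\,ds\qquad\text{for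 all }H\in\mathcal C;$$ (ii) for each $i=1,\dots,k$, $\rho\in L^2(0,T;\mathcal H^1(b_i,b_{i+1}))$: that is, $\rho\in L^2([0,T]\times[b_i,b_{i+1}])$, and there is a function $g\in L^2([0,T]\times[b_i,b_{i+1}])$ such that $\int_0^T\!\int_{b_i}^{b_{i+1}}\partial_uH\,\rho\,du\,ds=-\int_0^T\!\int_{b_i}^{b_{i+1}}H\,g\,du\,ds$ for all $H$ of class $C^{0,1}$ with compact support in $[0,T]\times(b_i,b_{i+1})$. Moreover, $\mathcal E(\pi)=\sup_{H\in\mathcal C}\big\{\int_0^T\!\int_{\mathbb T}\partial_uH\,\rho^\pi\,du\,ds-2\int_0^T\!\int_{\mathbb T}H^2\,du\,ds\big\}\in[0,\infty]$ is $\mathbb Q_*$-almost everywhere measurable and, for every $\alpha\in(0,1)$, an entropy constant exists and $$E_{\mathbb Q_*}[\mathcal E]\le K_0\qquad\text{for every entropy constant }K_0\text{ for }\alpha.$$ -/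

import Mathlib

open MeasureTheory ProbabilityTheory Filter Topology Set
open scoped NNReal ENNReal

namespace SlowBond

noncomputable section

/-! ### The exclusion process with slow bonds -/

/-- Configurations `η ∈ {0,1}^{𝕋_N}`; `η x = true` means that the site `x` is occupied. -/
abbrev Config (N : ℕ) : Type := ZMod N → Bool

/-- The occupation number `η(x) ∈ {0,1}`. -/
def occ {N : ℕ} (η : Config N) (x : ZMod N) : ℝ := if η x then 1 else 0

/-- `η^{x,x+1}`: the values of `η` at `x` and `x+1` are exchanged. -/
def exchange {N : ℕ} (x : ZMod N) (η : Config N) : Config N :=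
  fun y => η (Equiv.swap x (x + 1) y)

/-- The bond `{x, x+1}` is slow: the arc `(x/N, (x+1)/N]` of the torus contains some `b i`. -/
def IsSlow {k : ℕ} (b : Fin k → ℝ) {N : ℕ} (x : ZMod N) : Prop :=
  ∃ i, (b i : UnitAddCircle) ∈
    (fun r : ℝ => (r : UnitAddCircle)) '' Ioc ((x.val : ℝ) / N) (((x.val : ℝ) + 1) / N)

open Classical in
/-- The conductance `ξ^N_{x,x+1}`. -/
def conductance {k : ℕ} (β : ℝ) (b : Fin k → ℝ) {N : ℕ} (x : ZMod N) : ℝ :=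
  if IsSlow b x then (N : ℝ) ^ (-β) else 1

/-- The generator `L_N f(η) = ∑ₓ ξ_{x,x+1} [f(η^{x,x+1}) - f(η)]`. -/
def generator {k : ℕ} (β : ℝ) (b : Fin k → ℝ) (N : ℕ) [NeZero N] :
    (Config N → ℝ) →ₗ[ℝ] (Config N → ℝ) where
  toFun f η := ∑ x : ZMod N, conductance β b x * (f (exchange x η) - f η)
  map_add' f g := by
    funext η
    simp only [Pi.add_apply, ← Finset.sum_add_distrib]
    exact Finset.sum_congr rfl fun x _ => by ring
  map_smul' c f := by
    funext η
    simp only [Pi.smul_apply, smul_eq_mul, RingHom.id_apply, Finset.mul_sum]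
    exact Finset.sum_congr rfl fun x _ => by ring

/-- The semigroup `exp(t N² L_N)` of the process speeded up by `N²`. -/
def semigroup {k : ℕ} (β : ℝ) (b : Fin k → ℝ) (N : ℕ) [NeZero N] (t : ℝ) :
    (Config N → ℝ) →L[ℝ] (Config N → ℝ) :=
  NormedSpace.exp ((t * (N : ℝ) ^ 2) • LinearMap.toContinuousLinearMap (generator β b N))

/-- Transition probabilities `p_t(η, ζ)` of the process speeded up by `N²`. -/
def transition {k : ℕ} (β : ℝ) (b : Fin k → ℝ) (N : ℕ) [NeZero N] (t : ℝ)
    (η ζ : Config N) : ℝ :=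
  semigroup β b N t (Pi.single ζ 1) η

/-- Right-continuous paths with left limits. -/
def IsCadlag {ι E : Type*} [TopologicalSpace ι] [Preorder ι] [TopologicalSpace E]
    (x : ι → E) : Prop :=
  ∀ t, ContinuousWithinAt x (Ici t) t ∧ ∃ l, Tendsto x (𝓝[<] t) (𝓝 l)

/-- The path space `D(ℝ₊, {0,1}^{𝕋_N})`, with the `σ`-algebra generated by the evaluations. -/
abbrev ConfigPath (N : ℕ) : Type := {ω : ℝ≥0 → Config N // IsCadlag ω}

/-- `P` is the law on `D(ℝ₊, {0,1}^{𝕋_N})` of the Markov process with generator `N² L_N` and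
initial distribution `μ`, given by its finite-dimensional distributions. -/
structure IsExclusionLaw {k : ℕ} (β : ℝ) (b : Fin k → ℝ) (N : ℕ) [NeZero N]
    (μ : Measure (Config N)) (P : Measure (ConfigPath N)) : Prop where
  isProbabilityMeasure : IsProbabilityMeasure P
  finite_dim : ∀ (n : ℕ) (t : Fin (n + 1) → ℝ≥0) (ζ : Fin (n + 1) → Config N),
    Monotone t → t 0 = 0 →
    P {ω | ∀ i, ω.1 (t i) = ζ i} = μ {ζ 0} *
      ∏ i : Fin n, ENNReal.ofReal
        (transition β b N ((t i.succ : ℝ) - (t i.castSucc : ℝ)) (ζ i.castSucc) (ζ i.succ))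

/-- The measures `μ_N` on `{0,1}^{𝕋_N}` are associated to the profile `γ`. -/
def IsAssociated (μ : ∀ N : ℕ+, Measure (Config N)) (γ : UnitAddCircle → ℝ) : Prop :=
  ∀ δ : ℝ, 0 < δ → ∀ H : C(UnitAddCircle, ℝ),
    Tendsto (fun N : ℕ+ => μ N {η | δ < |(1 / (N : ℝ)) *
        ∑ x : ZMod N, H (ZMod.toAddCircle x) * occ η x - ∫ u, H u * γ u|})
      atTop (𝓝 0)

/-! ### The Bernoulli product measures and the entropy bound -/

/-- The Bernoulli product measure `ν_α` on `{0,1}^{𝕋_N}`. -/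
def bernoulliProduct (α : ℝ) (N : ℕ) [NeZero N] : Measure (Config N) :=
  Measure.pi fun _ =>
    ENNReal.ofReal α • Measure.dirac true + ENNReal.ofReal (1 - α) • Measure.dirac false

/-- `K₀` is a constant for which the relative entropy with respect to `ν_α` satisfies
`H_N(μ | ν_α) ≤ K₀ N` for all `N ≥ 1` and all probability measures `μ` on `{0,1}^{𝕋_N}`. -/
def IsEntropyConstant (α K₀ : ℝ) : Prop :=
  ∀ (N : ℕ+) (μ : Measure (Config N)), IsProbabilityMeasure μ →
    InformationTheory.klDiv μ (bernoulliProduct α N) ≤ ENNReal.ofReal (K₀ * (N : ℝ))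

/-! ### The Skorohod space -/

/-- The space `𝓜` of positive measures on the torus with total mass at most one. -/
def SubProb : Type := {ν : FiniteMeasure UnitAddCircle // ν.mass ≤ 1}

/-- The weak topology on `𝓜`. -/
instance : TopologicalSpace SubProb :=
  inferInstanceAs (TopologicalSpace {ν : FiniteMeasure UnitAddCircle // ν.mass ≤ 1})

/-- The measure underlying an element of `𝓜`. -/
def SubProb.toMeasure (ν : SubProb) : Measure UnitAddCircle := (ν.1 : Measure UnitAddCircle)

/-- Integration of continuous functions against an element of `𝓜`. -/
def SubProb.pairing (ν : SubProb) (f : C(UnitAddCircle, ℝ)) : ℝ := ∫ u, f u ∂ν.toMeasure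

theorem SubProb.topology_eq :
    (inferInstance : TopologicalSpace SubProb) =
      (UniformSpace.comap SubProb.pairing inferInstance).toTopologicalSpace := by
  have h1 : IsInducing SubProb.pairing := by
    refine isInducing_iff_nhds.2 fun ν => le_antisymm ?_ ?_
    · rw [← tendsto_iff_comap]
      refine tendsto_pi_nhds.2 fun f => ?_
      have h2 : Tendsto (fun ν : SubProb => ν.1) (𝓝 ν) (𝓝 ν.1) :=
        (continuous_subtype_val (p := fun ν : FiniteMeasure UnitAddCircle => ν.mass ≤ 1)).tendsto ν
      exact (FiniteMeasure.tendsto_iff_forall_integral_tendsto.1 h2)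
        (BoundedContinuousFunction.mkOfCompact f)
    · have h3 : IsInducing (fun ν : SubProb => ν.1) :=
        IsInducing.subtypeVal (t := {ν : FiniteMeasure UnitAddCircle | ν.mass ≤ 1})
      rw [h3.nhds_eq_comap, ← tendsto_iff_comap]
      refine FiniteMeasure.tendsto_iff_forall_integral_tendsto.2 fun f => ?_
      have h4 : Tendsto SubProb.pairing (comap SubProb.pairing (𝓝 ν.pairing)) (𝓝 ν.pairing) :=
        tendsto_comap
      exact (tendsto_pi_nhds.1 h4) f.toContinuousMap
  exact h1.eq_induced

/-- The uniform structure on `𝓜` of convergence against continuous functions. The underlying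
topology is the weak topology. -/
instance : UniformSpace SubProb :=
  (UniformSpace.comap SubProb.pairing inferInstance).replaceTopology SubProb.topology_eq

/-- The space `D([0,T], E)` of càdlàg paths. -/
def SkorohodSpace (T : ℝ) (E : Type*) [TopologicalSpace E] : Type _ :=
  {x : Icc (0 : ℝ) T → E // IsCadlag x}

/-- `x` and `y` are close in the Skorohod sense: for some increasing bijection `r` of `[0,T]` with
`sup |r t - t| ≤ ε`, the points `x (r t)` and `y t` are `V`-close for all `t`. -/
def skorohodRel {T : ℝ} {E : Type*} [UniformSpace E] (ε : ℝ) (V : Set (E × E)) :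
    Set (SkorohodSpace T E × SkorohodSpace T E) :=
  {p | ∃ r : Icc (0 : ℝ) T ≃o Icc (0 : ℝ) T,
    (∀ t, |(r t : ℝ) - t| ≤ ε) ∧ ∀ t, (p.1.1 (r t), p.2.1 t) ∈ V}

/-- The sets `skorohodRel ε V`, for `ε > 0` and `V` an entourage, form a filter basis. -/
def skorohodBasis (T : ℝ) (E : Type*) [UniformSpace E] :
    FilterBasis (SkorohodSpace T E × SkorohodSpace T E) where
  sets := {S | ∃ ε : ℝ, 0 < ε ∧ ∃ V ∈ uniformity E, S = skorohodRel ε V}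
  nonempty := ⟨_, 1, one_pos, univ, univ_mem, rfl⟩
  inter_sets := by
    rintro _ _ ⟨ε, hε, V, hV, rfl⟩ ⟨ε', hε', V', hV', rfl⟩
    refine ⟨_, ⟨min ε ε', lt_min hε hε', V ∩ V', inter_mem hV hV', rfl⟩, ?_⟩
    rintro p ⟨r, h1, h2⟩
    exact ⟨⟨r, fun t => (h1 t).trans (min_le_left _ _), fun t => (h2 t).1⟩,
      ⟨r, fun t => (h1 t).trans (min_le_right _ _), fun t => (h2 t).2⟩⟩

/-- The (`J₁`) Skorohod topology on `D([0,T], E)`. -/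
instance (T : ℝ) (E : Type*) [UniformSpace E] : UniformSpace (SkorohodSpace T E) :=
  UniformSpace.ofCore <| UniformSpace.Core.mkOfBasis (skorohodBasis T E)
    (by
      rintro _ ⟨ε, hε, V, hV, rfl⟩ x
      exact ⟨OrderIso.refl _, fun t => by simpa using hε.le, fun t => refl_mem_uniformity hV⟩)
    (by
      rintro _ ⟨ε, hε, V, hV, rfl⟩
      refine ⟨_, ⟨ε, hε, Prod.swap ⁻¹' V, symm_le_uniformity hV, rfl⟩, ?_⟩
      rintro p ⟨r, h1, h2⟩
      refine ⟨r.symm, fun t => ?_, fun t => ?_⟩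
      · have := h1 (r.symm t)
        rw [OrderIso.apply_symm_apply, abs_sub_comm] at this
        exact this
      · have := h2 (r.symm t)
        rw [OrderIso.apply_symm_apply] at this
        exact this)
    (by
      rintro _ ⟨ε, hε, V, hV, rfl⟩
      obtain ⟨W, hW, hWV⟩ := comp_mem_uniformity_sets hV
      refine ⟨_, ⟨ε / 2, half_pos hε, W, hW, rfl⟩, ?_⟩
      rintro ⟨x, z⟩ ⟨y, ⟨r, h1, h2⟩, ⟨q, h3, h4⟩⟩
      refine ⟨q.trans r, fun t => ?_, fun t => hWV ⟨y.1 (q t), h2 (q t), h4 t⟩⟩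
      have e1 := h1 (q t)
      have e2 := h3 t
      have e3 := abs_sub_le ((r (q t) : Icc (0 : ℝ) T) : ℝ) (q t : ℝ) (t : ℝ)
      simp only [OrderIso.trans_apply]
      linarith)

instance (T : ℝ) (E : Type*) [UniformSpace E] : MeasurableSpace (SkorohodSpace T E) := borel _

instance (T : ℝ) (E : Type*) [UniformSpace E] : BorelSpace (SkorohodSpace T E) := ⟨rfl⟩

/-! ### The empirical process -/

/-- The empirical measure `N⁻¹ ∑ₓ η(x) δ_{x/N}`, as a measure. -/
def empiricalMeasure {N : ℕ} [NeZero N] (η : Config N) : Measure UnitAddCircle :=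
  (N : ℝ≥0∞)⁻¹ • ∑ x : ZMod N, if η x then Measure.dirac (ZMod.toAddCircle x) else 0

theorem empiricalMeasure_univ_le {N : ℕ} [NeZero N] (η : Config N) :
    empiricalMeasure η univ ≤ 1 := by
  have h : ∀ x : ZMod N,
      (if η x then Measure.dirac (ZMod.toAddCircle x) else 0 : Measure UnitAddCircle) univ ≤ 1 := by
    intro x
    split_ifs <;> simp
  have hN : (N : ℝ≥0∞) ≠ 0 := by exact_mod_cast NeZero.ne N
  calc empiricalMeasure η univ
      = (N : ℝ≥0∞)⁻¹ * ∑ x : ZMod N,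
        (if η x then Measure.dirac (ZMod.toAddCircle x) else 0 : Measure UnitAddCircle) univ := by
        simp [empiricalMeasure, Measure.finsetSum_apply]
    _ ≤ (N : ℝ≥0∞)⁻¹ * ∑ _x : ZMod N, 1 := by
        gcongr with x
        exact h x
    _ = 1 := by
        simp [ZMod.card, ENNReal.inv_mul_cancel hN (ENNReal.natCast_ne_top N)]

/-- The empirical measure as an element of `𝓜`. -/
def empirical {N : ℕ} [NeZero N] (η : Config N) : SubProb :=
  ⟨⟨empiricalMeasure η, ⟨(empiricalMeasure_univ_le η).trans_lt ENNReal.one_lt_top⟩⟩,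
    ENNReal.toNNReal_mono ENNReal.one_ne_top (empiricalMeasure_univ_le η)⟩

/-- The map `η_· ↦ (π^N_t)_{0 ≤ t ≤ T}` from `D(ℝ₊, {0,1}^{𝕋_N})` to `D([0,T], 𝓜)`. -/
def empiricalPath (N : ℕ) [NeZero N] (T : ℝ) (ω : ConfigPath N) : SkorohodSpace T SubProb :=
  ⟨fun t => empirical (ω.1 ⟨t, t.2.1⟩), by
    have hc : Continuous (empirical : Config N → SubProb) := continuous_of_discreteTopology
    have hi : Continuous fun t : Icc (0 : ℝ) T => (⟨t, t.2.1⟩ : ℝ≥0) :=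
      Continuous.subtype_mk continuous_subtype_val _
    intro t
    obtain ⟨h1, l, h2⟩ := ω.2 ⟨t, t.2.1⟩
    refine ⟨?_, empirical l, ?_⟩
    · refine (hc.tendsto _).comp (h1.tendsto.comp ?_)
      exact tendsto_nhdsWithin_of_tendsto_nhds_of_eventually_within _
        (hi.continuousWithinAt.tendsto) (eventually_mem_nhdsWithin.mono fun s hs => hs)
    · refine (hc.tendsto _).comp (h2.comp ?_)
      exact tendsto_nhdsWithin_of_tendsto_nhds_of_eventually_within _
        (hi.continuousWithinAt.tendsto) (eventually_mem_nhdsWithin.mono fun s hs => hs)⟩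

/-! ### Test functions, energy and Sobolev spaces -/

/-- The space-time domain `[0,T] × 𝕋`. -/
abbrev Cylinder (T : ℝ) : Type := Icc (0 : ℝ) T × UnitAddCircle

/-- Lebesgue measure on `[0,T]`. -/
def timeMeasure (T : ℝ) : Measure (Icc (0 : ℝ) T) := Measure.comap Subtype.val volume

/-- Lebesgue measure `ds du` on `[0,T] × 𝕋`. -/
def cylinderMeasure (T : ℝ) : Measure (Cylinder T) := (timeMeasure T).prod volume

/-- Lebesgue measure `ds du` on `[0,T] × [a,c]`. -/
def stripMeasure (T a c : ℝ) : Measure (Icc (0 : ℝ) T × ℝ) :=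
  (timeMeasure T).prod (volume.restrict (Icc a c))

/-- The torus points `{b_1, …, b_k}`. -/
def slowPoints {k : ℕ} (b : Fin k → ℝ) : Set UnitAddCircle :=
  range fun i => (b i : UnitAddCircle)

/-- Functions `H ∈ C^{0,1}([0,T] × 𝕋)`, with space derivative `dH`, whose (closed) support is
contained in `[0,T] × (𝕋 ∖ B)`. -/
structure TorusTest (T : ℝ) (B : Set UnitAddCircle) where
  H : Cylinder T → ℝ
  dH : Cylinder T → ℝ
  continuous_H : Continuous H
  continuous_dH : Continuous dH
  hasDerivAt : ∀ (t : Icc (0 : ℝ) T) (u : ℝ),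
    HasDerivAt (fun v : ℝ => H (t, (v : UnitAddCircle))) (dH (t, (u : UnitAddCircle))) u
  support : tsupport H ⊆ univ ×ˢ Bᶜ

/-- `g` is a weak space derivative of `ρ` in `L²([0,T] × 𝕋)`, tested against functions with support
in `[0,T] × (𝕋 ∖ B)`. -/
def IsWeakDeriv {T : ℝ} (B : Set UnitAddCircle) (ρ g : Cylinder T → ℝ) : Prop :=
  MemLp g 2 (cylinderMeasure T) ∧ ∀ φ : TorusTest T B,
    ∫ p, φ.dH p * ρ p ∂cylinderMeasure T = -∫ p, φ.H p * g p ∂cylinderMeasure T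

/-- The energy `sup_H {∫∫ ∂_u H ρ - 2 ∫∫ H²}`. As `H = 0` is allowed, the supremum is
nonnegative and may be computed in `[0,∞]`. -/
def energy {T : ℝ} (B : Set UnitAddCircle) (ρ : Cylinder T → ℝ) : ℝ≥0∞ :=
  ⨆ φ : TorusTest T B, ENNReal.ofReal
    ((∫ p, φ.dH p * ρ p ∂cylinderMeasure T) - 2 * ∫ p, φ.H p ^ 2 ∂cylinderMeasure T)

/-- Functions `H` of class `C^{0,1}` with compact support in `[0,T] × (a,c)` (extended by zero to
`[0,T] × ℝ`), with space derivative `dH`. -/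
structure IntervalTest (T a c : ℝ) where
  H : Icc (0 : ℝ) T × ℝ → ℝ
  dH : Icc (0 : ℝ) T × ℝ → ℝ
  continuous_H : Continuous H
  continuous_dH : Continuous dH
  hasDerivAt : ∀ (t : Icc (0 : ℝ) T) (u : ℝ), HasDerivAt (fun v : ℝ => H (t, v)) (dH (t, u)) u
  compactSupport : HasCompactSupport H
  support : tsupport H ⊆ univ ×ˢ Ioo a c

/-- `ϱ` belongs to `L²(0,T; H¹(a,c))`. -/
def MemL2H1 (T a c : ℝ) (ϱ : Icc (0 : ℝ) T × ℝ → ℝ) : Prop :=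
  MemLp ϱ 2 (stripMeasure T a c) ∧
  ∃ g : Icc (0 : ℝ) T × ℝ → ℝ, MemLp g 2 (stripMeasure T a c) ∧
    ∀ φ : IntervalTest T a c,
      ∫ p, φ.dH p * ϱ p ∂stripMeasure T a c = -∫ p, φ.H p * g p ∂stripMeasure T a c

/-- The right end point `b_{i+1}` of the interval that starts at `b_i`; the last interval
ends at `b_1 + 1`, which is the point `b_1` of the torus. -/
def nextPoint {k : ℕ} (b : Fin k → ℝ) (i : Fin k) : ℝ :=
  if h : (i : ℕ) + 1 < k then b ⟨i + 1, h⟩ else b ⟨0, i.pos⟩ + 1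

/-- `ρ : [0,T] × 𝕋 → [0,1]` is measurable and `π_t(du) = ρ(t,u) du` for all `t ∈ [0,T]`. -/
def IsDensity {T : ℝ} (π : SkorohodSpace T SubProb) (ρ : Cylinder T → ℝ) : Prop :=
  Measurable ρ ∧ (∀ p, ρ p ∈ Icc (0 : ℝ) 1) ∧
    ∀ t, (π.1 t).toMeasure = volume.withDensity fun u => ENNReal.ofReal (ρ (t, u))

end

end SlowBond

/-!
The uniform measure is reversible for the exclusion process, and every initial law has density at
most `2^N` with respect to it. By the Feynman–Kac bound, `E[exp ∫ w_s(η_s) ds] ≤ 2^N` whenever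
`⟨w_s, f²⟩ ≤ N² D(f)` for all `s` and `f`, where `D` is the Dirichlet form. This holds for
`w_s(η) = N ∑ₓ (H(s,(x+1)/N) - H(s,x/N)) η(x) - ½ ∑ₓ H(s,x/N)²`: after a summation by parts the
slow bonds drop out because `H` vanishes near the slow points, and Young's inequality bounds every
other term by the Dirichlet form on its bond and by `H²`. Hence
`exp (N (∫⟨π_s, ∂_u H⟩ ds - 2 ∫∫ H²))` has expectation at most `2^N exp (o(N))`. The same holds for
a maximum over finitely many `H`, so by Jensen's inequality the expected maximum is asymptotically
at most `log 2`. In the limit this bounds the expected energy by `log 2`, which every entropy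
constant dominates: test it on Dirac masses at `N = 1`.

At most one particle per site forces limiting measures to be dominated by Lebesgue measure. Finite
energy says that `H ↦ ∫∫ ∂_u H ρ` is bounded in `L²`, and the Riesz representation theorem yields
the weak derivative. A test function on an interval between consecutive slow points periodizes to
a test function on the torus, which gives the local Sobolev regularity.
-/

namespace SlowBond

noncomputable section

/-! ### Entropy constants -/

theorem rnDeriv_mul_singleton {S : Type*} [MeasurableSpace S] [MeasurableSingletonClass S]
    {μ ν : Measure S} [SigmaFinite μ] [SigmaFinite ν] (hac : μ ≪ ν) (a : S) :
    μ.rnDeriv ν a * ν {a} = μ {a} := by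
  rw [← lintegral_singleton, Measure.setLIntegral_rnDeriv hac]

theorem absolutelyContinuous_of_singleton_ne_zero {S : Type*} [MeasurableSpace S]
    (μ : Measure S) {ν : Measure S} (hν : ∀ a, ν {a} ≠ 0) : μ ≪ ν := by
  intro s hs
  rcases s.eq_empty_or_nonempty with rfl | ⟨a, ha⟩
  · exact measure_empty
  · exact absurd (measure_mono_null (singleton_subset_iff.2 ha) hs) (hν a)

theorem klDiv_le_log_of_one_le_mul_singleton {S : Type*} [Finite S] [MeasurableSpace S]
    [MeasurableSingletonClass S] (μ ν : Measure S) [IsProbabilityMeasure μ]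
    [IsProbabilityMeasure ν] {C : ℝ} (hC0 : 0 < C) (hC : ∀ a, 1 ≤ ENNReal.ofReal C * ν {a}) :
    InformationTheory.klDiv μ ν ≤ ENNReal.ofReal (Real.log C) := by
  have hac : μ ≪ ν :=
    absolutelyContinuous_of_singleton_ne_zero μ fun a ha => by simpa [ha] using hC a
  have hderiv : ∀ a, μ.rnDeriv ν a ≤ ENNReal.ofReal C := fun a =>
    calc μ.rnDeriv ν a
      _ ≤ μ.rnDeriv ν a * (ENNReal.ofReal C * ν {a}) := le_mul_of_one_le_right' (hC a)
      _ = ENNReal.ofReal C * μ {a} := by rw [← rnDeriv_mul_singleton hac]; ring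
      _ ≤ ENNReal.ofReal C := mul_le_of_le_one_right' prob_le_one
  have hint : Integrable (llr μ ν) μ := Integrable.of_finite
  rw [InformationTheory.klDiv_of_ac_of_integrable hac hint]
  refine ENNReal.ofReal_le_ofReal ?_
  simp only [probReal_univ, add_sub_cancel_right]
  calc ∫ x, llr μ ν x ∂μ ≤ ∫ _x, Real.log C ∂μ := by
        refine integral_mono_ae hint (integrable_const _) ?_
        filter_upwards [Measure.rnDeriv_pos hac, hac.ae_le (Measure.rnDeriv_lt_top μ ν)]
          with a hpos htop
        exact Real.log_le_log (ENNReal.toReal_pos hpos.ne' htop.ne)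
          (ENNReal.toReal_le_of_le_ofReal hC0.le (hderiv a))
    _ = Real.log C := by simp

theorem klDiv_dirac {S : Type*} [MeasurableSpace S] [MeasurableSingletonClass S]
    (ν : Measure S) [IsProbabilityMeasure ν] {a : S} (ha : ν {a} ≠ 0) :
    InformationTheory.klDiv (Measure.dirac a) ν = ENNReal.ofReal (-Real.log (ν.real {a})) := by
  have hac : Measure.dirac a ≪ ν := by
    refine Measure.AbsolutelyContinuous.mk fun s hs hs0 => ?_
    rw [Measure.dirac_apply' a hs, indicator_of_notMem]
    exact fun has => ha (measure_mono_null (singleton_subset_iff.2 has) hs0)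
  have hderiv : (Measure.dirac a).rnDeriv ν a = (ν {a})⁻¹ :=
    ENNReal.eq_inv_of_mul_eq_one_left (by simp [rnDeriv_mul_singleton hac])
  rw [InformationTheory.klDiv_of_ac_of_integrable hac (integrable_dirac (by simp))]
  simp only [probReal_univ, add_sub_cancel_right, integral_dirac]
  rw [llr, hderiv, ENNReal.toReal_inv, Real.log_inv, measureReal_def]

section Bernoulli

variable {α : ℝ} (hα : α ∈ Ioo (0 : ℝ) 1)
include hα

theorem isProbabilityMeasure_coin : IsProbabilityMeasure
    (ENNReal.ofReal α • Measure.dirac true + ENNReal.ofReal (1 - α) • Measure.dirac false) := by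
  constructor
  simp only [Measure.coe_add, Measure.coe_smul, Pi.add_apply, Pi.smul_apply, measure_univ,
    smul_eq_mul, mul_one]
  rw [← ENNReal.ofReal_add hα.1.le (by linarith [hα.2]), add_sub_cancel, ENNReal.ofReal_one]

theorem isProbabilityMeasure_bernoulliProduct (N : ℕ) [NeZero N] :
    IsProbabilityMeasure (bernoulliProduct α N) := by
  have := isProbabilityMeasure_coin hα
  unfold bernoulliProduct
  infer_instance

theorem bernoulliProduct_singleton (N : ℕ) [NeZero N] (η : Config N) :
    bernoulliProduct α N {η} = ENNReal.ofReal (∏ x, if η x then α else 1 - α) := by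
  have := isProbabilityMeasure_coin hα
  rw [bernoulliProduct, Measure.pi_singleton, ENNReal.ofReal_prod_of_nonneg]
  · refine Finset.prod_congr rfl fun x _ => ?_
    cases η x <;> simp
  · intro x _
    split_ifs
    exacts [hα.1.le, sub_nonneg.2 hα.2.le]

theorem exists_isEntropyConstant : ∃ K₀, IsEntropyConstant α K₀ := by
  set m := min α (1 - α)
  have hm : 0 < m := lt_min hα.1 (sub_pos.2 hα.2)
  refine ⟨-Real.log m, fun N μ hμ => ?_⟩
  have := isProbabilityMeasure_bernoulliProduct hα N
  have hle := klDiv_le_log_of_one_le_mul_singleton μ (bernoulliProduct α N)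
    (C := (m ^ (N : ℕ))⁻¹) (by positivity) fun η => by
      rw [bernoulliProduct_singleton hα, ← ENNReal.ofReal_mul (by positivity),
        ENNReal.one_le_ofReal, one_le_inv_mul₀ (by positivity)]
      calc m ^ (N : ℕ) = ∏ _x : ZMod N, m := by simp [ZMod.card]
        _ ≤ ∏ x, if η x then α else 1 - α :=
          Finset.prod_le_prod (fun _ _ => hm.le) fun x _ => inf_le_ite _ _ _
  rwa [Real.log_inv, Real.log_pow, ← mul_neg, mul_comm] at hle

theorem IsEntropyConstant.neg_log_le {K₀ : ℝ} (hK : IsEntropyConstant α K₀) (c : Bool) :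
    -Real.log (if c then α else 1 - α) ≤ K₀ := by
  have := isProbabilityMeasure_bernoulliProduct hα 1
  have hc0 : 0 < if c then α else 1 - α := by
    split_ifs
    exacts [hα.1, sub_pos.2 hα.2]
  have hc1 : (if c then α else 1 - α) < 1 := by
    split_ifs
    exacts [hα.2, sub_lt_self 1 hα.1]
  have hν : bernoulliProduct α 1 {fun _ => c} = ENNReal.ofReal (if c then α else 1 - α) := by
    rw [bernoulliProduct_singleton hα, Fintype.prod_unique]
  have hkl : InformationTheory.klDiv (Measure.dirac fun _ => c) (bernoulliProduct α 1)
      ≤ ENNReal.ofReal (K₀ * (1 : ℕ)) := hK 1 (Measure.dirac fun _ => c) inferInstance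
  rw [klDiv_dirac _ (by rw [hν]; simpa using hc0), measureReal_def, hν,
    ENNReal.toReal_ofReal hc0.le, Nat.cast_one, mul_one, ENNReal.ofReal_le_ofReal_iff'] at hkl
  exact hkl.resolve_right (by linarith [Real.log_neg hc0 hc1])

theorem IsEntropyConstant.log_two_le {K₀ : ℝ} (hK : IsEntropyConstant α K₀) :
    Real.log 2 ≤ K₀ := by
  have hlog : ∀ x : ℝ, 0 < x → x ≤ 2⁻¹ → Real.log 2 ≤ -Real.log x := fun x hx hx2 => by
    rw [← Real.log_inv]
    exact Real.log_le_log two_pos ((le_inv_comm₀ two_pos hx).2 hx2)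
  rcases le_total α 2⁻¹ with hle | hle
  · exact (hlog α hα.1 hle).trans (hK.neg_log_le hα true)
  · exact (hlog (1 - α) (sub_pos.2 hα.2) (by linarith)).trans (hK.neg_log_le hα false)

end Bernoulli

/-! ### Exponentials of dissipative matrices -/

section BanachAlgebra

variable {𝔸 : Type*} [NormedRing 𝔸] [NormedAlgebra ℝ 𝔸] [CompleteSpace 𝔸]

theorem hasSum_exp_sub_one_sub_self (x : 𝔸) :
    HasSum (fun n : ℕ => ((n + 2).factorial : ℝ)⁻¹ • x ^ (n + 2)) (NormedSpace.exp x - 1 - x) := by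
  have h := (hasSum_nat_add_iff' 2).2 (NormedSpace.exp_series_hasSum_exp' (𝕂 := ℝ) x)
  simpa [Finset.sum_range_succ, sub_sub] using h

theorem norm_exp_sub_one_sub_self_le {x : 𝔸} (hx : ‖x‖ ≤ 1) :
    ‖NormedSpace.exp x - 1 - x‖ ≤ ‖x‖ ^ 2 := by
  have hnorm : ‖NormedSpace.exp x - 1 - x‖ ≤ Real.exp ‖x‖ - 1 - ‖x‖ := by
    rw [Real.exp_eq_exp_ℝ]
    refine (hasSum_exp_sub_one_sub_self x).norm_le_of_bounded (hasSum_exp_sub_one_sub_self ‖x‖) ?_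
    intro n
    rw [norm_smul, Real.norm_of_nonneg (by positivity), smul_eq_mul]
    gcongr
    exact norm_pow_le' x (by positivity)
  calc _ ≤ |Real.exp ‖x‖ - 1 - ‖x‖| := hnorm.trans (le_abs_self _)
    _ ≤ ‖x‖ ^ 2 := Real.abs_exp_sub_one_sub_id_le (by simpa using hx)

theorem norm_exp_mul_exp_sub_le {x y : 𝔸} {r : ℝ} (hx : ‖x‖ ≤ r) (hy : ‖y‖ ≤ r) (hr : r ≤ 1) :
    ‖NormedSpace.exp x * NormedSpace.exp y - (1 + (x + y))‖ ≤ 6 * r ^ 2 := by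
  have hr0 : 0 ≤ r := (norm_nonneg x).trans hx
  obtain ⟨p, hp⟩ : ∃ p, p = NormedSpace.exp x - 1 - x := ⟨_, rfl⟩
  obtain ⟨q, hq⟩ : ∃ q, q = NormedSpace.exp y - 1 - y := ⟨_, rfl⟩
  have hpr : ‖p‖ ≤ r ^ 2 := by
    rw [hp]
    exact (norm_exp_sub_one_sub_self_le (hx.trans hr)).trans (by gcongr)
  have hqr : ‖q‖ ≤ r ^ 2 := by
    rw [hq]
    exact (norm_exp_sub_one_sub_self_le (hy.trans hr)).trans (by gcongr)
  have hmul : ∀ {u v : 𝔸} {s t : ℝ}, 0 ≤ s → ‖u‖ ≤ s → ‖v‖ ≤ t → ‖u * v‖ ≤ s * t :=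
    fun hs hu hv => (norm_mul_le _ _).trans (mul_le_mul hu hv (norm_nonneg _) hs)
  calc ‖NormedSpace.exp x * NormedSpace.exp y - (1 + (x + y))‖
      = ‖p + q + x * y + x * q + p * y + p * q‖ := by
        congr 1
        rw [hp, hq]
        noncomm_ring
    _ ≤ r ^ 2 + r ^ 2 + r * r + r * r ^ 2 + r ^ 2 * r + r ^ 2 * r ^ 2 := by
        refine norm_add_le_of_le (norm_add_le_of_le (norm_add_le_of_le (norm_add_le_of_le
          (norm_add_le_of_le hpr hqr) ?_) ?_) ?_) ?_
        exacts [hmul hr0 hx hy, hmul hr0 hx hqr, hmul (sq_nonneg r) hpr hy,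
          hmul (sq_nonneg r) hpr hqr]
    _ ≤ 6 * r ^ 2 := by nlinarith [mul_nonneg (sq_nonneg r) (sub_nonneg.2 hr), sq_nonneg r]

end BanachAlgebra

theorem norm_one_add_le_of_inner_nonpos {E : Type*} [NormedAddCommGroup E] [InnerProductSpace ℝ E]
    {A : E →L[ℝ] E} (hA : ∀ v, inner ℝ v (A v) ≤ 0) : ‖1 + A‖ ≤ 1 + ‖A‖ ^ 2 := by
  refine ContinuousLinearMap.opNorm_le_bound _ (by positivity) fun v => ?_
  refine abs_le_of_sq_le_sq' ?_ (by positivity) |>.2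
  calc ‖v + A v‖ ^ 2 = ‖v‖ ^ 2 + 2 * inner ℝ v (A v) + ‖A v‖ ^ 2 := norm_add_sq_real _ _
    _ ≤ ‖v‖ ^ 2 + 2 * 0 + (‖A‖ * ‖v‖) ^ 2 := by
        gcongr
        exacts [hA v, A.le_opNorm v]
    _ = (1 + ‖A‖ ^ 2) * ‖v‖ ^ 2 := by ring
    _ ≤ (1 + ‖A‖ ^ 2) ^ 2 * ‖v‖ ^ 2 := by
        gcongr
        exact le_self_pow₀ (le_add_of_nonneg_right (sq_nonneg _)) two_ne_zero
    _ = ((1 + ‖A‖ ^ 2) * ‖v‖) ^ 2 := by ring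

section Matrix

open Matrix

variable {S : Type*} [Fintype S]

theorem sum_path_succ {R : Type*} [CommSemiring R] {n : ℕ} (K : Fin (n + 1) → Matrix S S R)
    (a : S → R) :
    ∑ ζ : Fin (n + 2) → S, a (ζ 0) * ∏ i, K i (ζ i.castSucc) (ζ i.succ) =
      ∑ ζ : Fin (n + 1) → S,
        (a ᵥ* K 0) (ζ 0) * ∏ i : Fin n, K i.succ (ζ i.castSucc) (ζ i.succ) := by
  rw [← (Fin.consEquiv fun _ => S).sum_comp, Fintype.sum_prod_type, Finset.sum_comm]
  refine Finset.sum_congr rfl fun ζ _ => ?_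
  simp only [vecMul, dotProduct, Finset.sum_mul, Fin.prod_univ_succ, Fin.consEquiv_apply,
    Fin.cons_zero, Fin.cons_succ, Fin.castSucc_zero, ← Fin.succ_castSucc, mul_assoc]

variable [DecidableEq S]

theorem pow_apply_nonneg {A : Matrix S S ℝ} (hA : ∀ i j, 0 ≤ A i j) (n : ℕ) (i j : S) :
    0 ≤ (A ^ n) i j := by
  induction n generalizing i j with
  | zero =>
    rw [pow_zero, one_apply]
    split_ifs <;> positivity
  | succ n ih =>
    rw [pow_succ, mul_apply]
    exact Finset.sum_nonneg fun l _ => mul_nonneg (ih i l) (hA l j)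

open scoped Matrix.Norms.L2Operator

theorem exp_apply_nonneg_of_nonneg {A : Matrix S S ℝ} (hA : ∀ i j, 0 ≤ A i j) (i j : S) :
    0 ≤ NormedSpace.exp A i j := by
  have := FiniteDimensional.complete ℝ (Matrix S S ℝ)
  have hentry : HasSum (fun n : ℕ => ((n.factorial : ℝ)⁻¹ • A ^ n) i j) (NormedSpace.exp A i j) :=
    (NormedSpace.exp_series_hasSum_exp' (𝕂 := ℝ) A).map (Matrix.entryAddMonoidHom ℝ i j)
      (continuous_id.matrix_elem i j)
  exact hentry.nonneg fun n => mul_nonneg (by positivity) (pow_apply_nonneg hA n i j)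

/-- Adding a large multiple `c` of the identity makes the matrix entrywise nonnegative, and changes
its exponential by the factor `exp c`. -/
theorem exp_apply_nonneg_of_offDiag_nonneg {G : Matrix S S ℝ} (hG : ∀ i j, i ≠ j → 0 ≤ G i j)
    (i j : S) : 0 ≤ NormedSpace.exp G i j := by
  obtain ⟨c, hc⟩ := Finite.exists_le fun l => -G l l
  have hnonneg : ∀ i j, 0 ≤ (G + c • (1 : Matrix S S ℝ)) i j := by
    intro i j
    rcases eq_or_ne i j with rfl | hij
    · simpa [add_comm, neg_le_iff_add_nonneg] using hc i
    · simpa [hij] using hG i j hij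
  have hsplit : G = (G + c • 1) + (-c) • 1 := by
    rw [add_assoc, ← add_smul, add_neg_cancel, zero_smul, add_zero]
  have hcomm : Commute (G + c • 1) ((-c) • 1) := (Commute.one_right _).smul_right _
  rw [hsplit, Matrix.exp_add_of_commute _ _ hcomm, smul_one_eq_diagonal (-c), exp_diagonal,
    mul_diagonal, Pi.coe_exp, ← Real.exp_eq_exp_ℝ]
  exact mul_nonneg (exp_apply_nonneg_of_nonneg hnonneg i j) (Real.exp_pos _).le

theorem norm_one_add_le_of_dotProduct_nonpos {A : Matrix S S ℝ}
    (hA : ∀ a : S → ℝ, a ⬝ᵥ A *ᵥ a ≤ 0) : ‖1 + A‖ ≤ 1 + ‖A‖ ^ 2 := by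
  rw [cstar_norm_def, cstar_norm_def, map_add, map_one]
  refine norm_one_add_le_of_inner_nonpos fun v => ?_
  rw [inner_toEuclideanCLM]
  exact hA v

theorem norm_exp_mul_exp_diagonal_le {G : Matrix S S ℝ} {w : S → ℝ} {r : ℝ} (hG : ‖G‖ ≤ r)
    (hw : ‖w‖ ≤ r) (hr : r ≤ 1) (hdiss : ∀ a : S → ℝ, a ⬝ᵥ (G + diagonal w) *ᵥ a ≤ 0) :
    ‖NormedSpace.exp G * diagonal fun i => Real.exp (w i)‖ ≤ 1 + 10 * r ^ 2 := by
  have := FiniteDimensional.complete ℝ (Matrix S S ℝ)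
  have hexp : (Matrix.diagonal fun i => Real.exp (w i)) = NormedSpace.exp (diagonal w) := by
    rw [Real.exp_eq_exp_ℝ, exp_diagonal, Pi.exp_def]
  have hw' : ‖diagonal w‖ ≤ r := (l2_opNorm_diagonal w).trans_le hw
  rw [hexp]
  calc ‖NormedSpace.exp G * NormedSpace.exp (diagonal w)‖
      ≤ ‖1 + (G + diagonal w)‖
        + ‖NormedSpace.exp G * NormedSpace.exp (diagonal w) - (1 + (G + diagonal w))‖ :=
        norm_le_insert' _ _
    _ ≤ (1 + ‖G + diagonal w‖ ^ 2) + 6 * r ^ 2 :=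
        add_le_add (norm_one_add_le_of_dotProduct_nonpos hdiss) (norm_exp_mul_exp_sub_le hG hw' hr)
    _ ≤ (1 + (r + r) ^ 2) + 6 * r ^ 2 := by
        gcongr
        exact norm_add_le_of_le hG hw'
    _ = 1 + 10 * r ^ 2 := by ring

theorem norm_vecMul_le (a : S → ℝ) (K : Matrix S S ℝ) :
    ‖WithLp.toLp 2 (a ᵥ* K)‖ ≤ ‖WithLp.toLp 2 a‖ * ‖K‖ := by
  rw [← mulVec_transpose, mul_comm, ← l2_opNorm_conjTranspose K,
    conjTranspose_eq_transpose_of_trivial]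
  exact l2_opNorm_mulVec Kᵀ (WithLp.toLp 2 a)

theorem sum_path_le (n : ℕ) (K : Fin n → Matrix S S ℝ) (a : S → ℝ) :
    ∑ ζ : Fin (n + 1) → S, a (ζ 0) * ∏ i, K i (ζ i.castSucc) (ζ i.succ) ≤
      ‖WithLp.toLp 2 a‖ * (∏ i, ‖K i‖) * √(Fintype.card S) := by
  induction n generalizing a with
  | zero =>
    have hinner : ∑ x, a x = inner ℝ (WithLp.toLp 2 a) (WithLp.toLp 2 (1 : S → ℝ)) := by
      simp [PiLp.inner_apply]
    have hone : ‖WithLp.toLp 2 (1 : S → ℝ)‖ = √(Fintype.card S) := by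
      simp [EuclideanSpace.norm_eq]
    have hpath : ∑ ζ : Fin 1 → S, a (ζ 0) = ∑ x, a x :=
      Fintype.sum_equiv (Equiv.funUnique (Fin 1) S) _ _ fun ζ => rfl
    simpa only [Finset.univ_eq_empty, Finset.prod_empty, mul_one, hpath, hinner, ← hone]
      using real_inner_le_norm _ _
  | succ n ih =>
    rw [sum_path_succ, Fin.prod_univ_succ, ← mul_assoc]
    refine (ih (fun i => K i.succ) (a ᵥ* K 0)).trans ?_
    gcongr
    exact norm_vecMul_le a (K 0)

theorem sum_path_exp_mul_exp_diagonal_le {G : Matrix S S ℝ} {n : ℕ} {v : Fin n → S → ℝ} {r : ℝ}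
    (hG : ‖G‖ ≤ r) (hv : ∀ i, ‖v i‖ ≤ r) (hr : r ≤ 1)
    (hdiss : ∀ i (a : S → ℝ), a ⬝ᵥ (G + diagonal (v i)) *ᵥ a ≤ 0) :
    ∑ ζ : Fin (n + 1) → S,
        ∏ i, (NormedSpace.exp G (ζ i.castSucc) (ζ i.succ) * Real.exp (v i (ζ i.succ))) ≤
      Fintype.card S * (1 + 10 * r ^ 2) ^ n := by
  have hone : ‖WithLp.toLp 2 (1 : S → ℝ)‖ = √(Fintype.card S) := by
    simp [EuclideanSpace.norm_eq]
  have hpaths := sum_path_le n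
    (fun i => NormedSpace.exp G * Matrix.diagonal fun x => Real.exp (v i x)) 1
  simp only [Pi.one_apply, one_mul, hone, mul_diagonal] at hpaths
  calc _ ≤ _ := hpaths
    _ = Fintype.card S * ∏ i, ‖NormedSpace.exp G * Matrix.diagonal fun x => Real.exp (v i x)‖ := by
        rw [mul_right_comm, Real.mul_self_sqrt (Nat.cast_nonneg _)]
    _ ≤ Fintype.card S * ∏ _i : Fin n, (1 + 10 * r ^ 2) := by
        gcongr with i
        exact norm_exp_mul_exp_diagonal_le hG (hv i) hr (hdiss i)
    _ = Fintype.card S * (1 + 10 * r ^ 2) ^ n := by simp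

end Matrix

/-! ### The Dirichlet form -/

section DirichletForm

open Matrix

variable {N : ℕ}

theorem exchange_involutive (x : ZMod N) : Function.Involutive (exchange x) := by
  intro η
  funext y
  simp [exchange]

theorem occ_exchange_left (x : ZMod N) (η : Config N) :
    occ (exchange x η) x = occ η (x + 1) := by
  simp [occ, exchange]

theorem occ_exchange_right (x : ZMod N) (η : Config N) :
    occ (exchange x η) (x + 1) = occ η x := by
  simp [occ, exchange]

theorem occ_mem_Icc (η : Config N) (x : ZMod N) : occ η x ∈ Icc (0 : ℝ) 1 := by
  unfold occ
  split_ifs <;> simp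

theorem abs_occ_sub_occ_le_one (η : Config N) (x y : ZMod N) : |occ η x - occ η y| ≤ 1 := by
  simpa using abs_sub_le_of_le_of_le (occ_mem_Icc η x).1 (occ_mem_Icc η x).2
    (occ_mem_Icc η y).1 (occ_mem_Icc η y).2

theorem conductance_nonneg {k : ℕ} {β : ℝ} {b : Fin k → ℝ} (x : ZMod N) :
    0 ≤ conductance β b x := by
  unfold conductance
  split_ifs <;> positivity

variable [NeZero N]

theorem sum_comp_exchange (x : ZMod N) (f : Config N → ℝ) :
    ∑ η, f (exchange x η) = ∑ η, f η :=
  Equiv.sum_comp (exchange_involutive x).toPerm f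

theorem sum_mul_exchange_sub (x : ZMod N) (a : Config N → ℝ) :
    ∑ η, a η * (a (exchange x η) - a η) = -(1 / 2) * ∑ η, (a (exchange x η) - a η) ^ 2 := by
  have hinvariance : ∑ η, a (exchange x η) ^ 2 = ∑ η, a η ^ 2 :=
    sum_comp_exchange x fun η => a η ^ 2
  have hexpand : ∑ η, (a (exchange x η) - a η) ^ 2
      = ∑ η, a (exchange x η) ^ 2 - ∑ η, a η ^ 2 - 2 * ∑ η, a η * (a (exchange x η) - a η) := by
    rw [Finset.mul_sum, ← Finset.sum_sub_distrib, ← Finset.sum_sub_distrib]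
    exact Finset.sum_congr rfl fun η _ => by ring
  rw [hexpand, hinvariance]
  ring

theorem two_mul_sum_occ_sub_mul (x : ZMod N) (f : Config N → ℝ) :
    2 * ∑ η, (occ η x - occ η (x + 1)) * f η
      = ∑ η, (occ η x - occ η (x + 1)) * (f η - f (exchange x η)) := by
  have hexchange := sum_comp_exchange x fun η => (occ η x - occ η (x + 1)) * f η
  simp only [occ_exchange_left, occ_exchange_right] at hexchange
  rw [two_mul]
  nth_rw 2 [← hexchange]
  rw [← Finset.sum_add_distrib]
  exact Finset.sum_congr rfl fun η _ => by ring

theorem two_mul_sum (x : ZMod N) (f : Config N → ℝ) :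
    2 * ∑ η, f η = ∑ η, (f η + f (exchange x η)) := by
  rw [Finset.sum_add_distrib, sum_comp_exchange, two_mul]

/-- Young's inequality for the product of `n (a - a')` and `c d (a + a')`. -/
theorem mul_mul_sq_sub_sq_le {d : ℝ} (hd : |d| ≤ 1) (n c a a' : ℝ) :
    n * c * (d * (a ^ 2 - a' ^ 2)) ≤ n ^ 2 * (a' - a) ^ 2 + c ^ 2 / 2 * (a ^ 2 + a' ^ 2) := by
  have hd2 : d ^ 2 ≤ 1 := (sq_le_one_iff_abs_le_one d).2 hd
  calc n * c * (d * (a ^ 2 - a' ^ 2))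
      = n ^ 2 * (a' - a) ^ 2 + d ^ 2 * (c * (a + a')) ^ 2 / 4
        - (n * (a - a') - c * d * (a + a') / 2) ^ 2 := by ring
    _ ≤ n ^ 2 * (a' - a) ^ 2 + 1 * (c * (a + a')) ^ 2 / 4 - 0 := by
        gcongr
        exact sq_nonneg _
    _ = n ^ 2 * (a' - a) ^ 2 + c ^ 2 / 2 * (a ^ 2 + a' ^ 2) - (c * (a - a')) ^ 2 / 4 := by ring
    _ ≤ n ^ 2 * (a' - a) ^ 2 + c ^ 2 / 2 * (a ^ 2 + a' ^ 2) :=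
        sub_le_self _ (by positivity)

theorem sum_occ_sub_mul_sq_le (x : ZMod N) (n c : ℝ) (a : Config N → ℝ) :
    n * c * ∑ η, (occ η x - occ η (x + 1)) * a η ^ 2 ≤
      n ^ 2 / 2 * ∑ η, (a (exchange x η) - a η) ^ 2 + c ^ 2 / 2 * ∑ η, a η ^ 2 := by
  have hpointwise := Finset.sum_le_sum fun η (_ : η ∈ Finset.univ) =>
    mul_mul_sq_sub_sq_le (abs_occ_sub_occ_le_one η x (x + 1)) n c (a η) (a (exchange x η))
  rw [Finset.sum_add_distrib, ← Finset.mul_sum, ← Finset.mul_sum, ← Finset.mul_sum,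
    ← two_mul_sum_occ_sub_mul x fun η => a η ^ 2, ← two_mul_sum x fun η => a η ^ 2] at hpointwise
  linarith

variable {k : ℕ} {β : ℝ} {b : Fin k → ℝ}

/-- The matrix of the generator `N² L_N`, with the jump rates off the diagonal. -/
def rateMatrix (β : ℝ) (b : Fin k → ℝ) (N : ℕ) [NeZero N] : Matrix (Config N) (Config N) ℝ :=
  (N : ℝ) ^ 2 • LinearMap.toMatrix' (generator β b N)

theorem rateMatrix_mulVec (a : Config N → ℝ) :
    rateMatrix β b N *ᵥ a = (N : ℝ) ^ 2 • generator β b N a := by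
  rw [rateMatrix, smul_mulVec, LinearMap.toMatrix'_mulVec]

theorem dotProduct_rateMatrix_mulVec (a : Config N → ℝ) :
    a ⬝ᵥ rateMatrix β b N *ᵥ a =
      -((N : ℝ) ^ 2 / 2) * ∑ x, conductance β b x * ∑ η, (a (exchange x η) - a η) ^ 2 := by
  have hgenerator : a ⬝ᵥ generator β b N a
      = ∑ x, conductance β b x * ∑ η, a η * (a (exchange x η) - a η) := by
    simp only [dotProduct, generator, LinearMap.coe_mk, AddHom.coe_mk, Finset.mul_sum]
    rw [Finset.sum_comm]
    exact Finset.sum_congr rfl fun x _ => Finset.sum_congr rfl fun η _ => mul_left_comm _ _ _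
  rw [rateMatrix_mulVec, dotProduct_smul, hgenerator, smul_eq_mul, Finset.mul_sum, Finset.mul_sum]
  refine Finset.sum_congr rfl fun x _ => ?_
  rw [sum_mul_exchange_sub]
  ring

theorem dotProduct_diagonal_mulVec_self {S : Type*} [Fintype S] [DecidableEq S] (w a : S → ℝ) :
    a ⬝ᵥ diagonal w *ᵥ a = ∑ i, w i * a i ^ 2 := by
  simp only [dotProduct, mulVec_diagonal]
  exact Finset.sum_congr rfl fun i _ => by ring

theorem sum_sub_mul_occ (h : ZMod N → ℝ) (η : Config N) :
    ∑ x, (h (x + 1) - h x) * occ η x = ∑ x, h (x + 1) * (occ η x - occ η (x + 1)) := by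
  have hshift := Equiv.sum_comp (Equiv.addRight (1 : ZMod N)) fun x => h x * occ η x
  simp only [Equiv.coe_addRight] at hshift
  simp only [mul_sub, sub_mul, Finset.sum_sub_distrib, hshift]

theorem mul_sum_occ_sub_mul_sq_le {h : ZMod N → ℝ} (hh : ∀ x, IsSlow b x → h (x + 1) = 0)
    (a : Config N → ℝ) (x : ZMod N) :
    N * h (x + 1) * ∑ η, (occ η x - occ η (x + 1)) * a η ^ 2 ≤
      (N : ℝ) ^ 2 / 2 * (conductance β b x * ∑ η, (a (exchange x η) - a η) ^ 2)
        + h (x + 1) ^ 2 / 2 * ∑ η, a η ^ 2 := by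
  by_cases hslow : IsSlow b x
  · have := conductance_nonneg (β := β) (b := b) x
    rw [hh x hslow, mul_zero, zero_mul]
    positivity
  · rw [conductance, if_neg hslow, one_mul]
    exact sum_occ_sub_mul_sq_le x N (h (x + 1)) a

theorem dotProduct_rateMatrix_add_discreteDerivative_nonpos {h : ZMod N → ℝ}
    (hh : ∀ x, IsSlow b x → h (x + 1) = 0) (a : Config N → ℝ) :
    a ⬝ᵥ (rateMatrix β b N + diagonal fun η : Config N =>
      N * ∑ x, (h (x + 1) - h x) * occ η x - 1 / 2 * ∑ x, h x ^ 2) *ᵥ a ≤ 0 := by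
  have hbonds := Finset.sum_le_sum fun x (_ : x ∈ Finset.univ) =>
    mul_sum_occ_sub_mul_sq_le (β := β) hh a x
  have hsq : ∑ x, h (x + 1) ^ 2 = ∑ x, h x ^ 2 :=
    Equiv.sum_comp (Equiv.addRight (1 : ZMod N)) fun x => h x ^ 2
  have hdrift : ∑ η : Config N, N * (∑ x, h (x + 1) * (occ η x - occ η (x + 1))) * a η ^ 2
      = ∑ x, N * h (x + 1) * ∑ η, (occ η x - occ η (x + 1)) * a η ^ 2 := by
    simp only [Finset.mul_sum, Finset.sum_mul, mul_assoc]
    exact Finset.sum_comm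
  rw [Finset.sum_add_distrib, ← Finset.mul_sum, ← Finset.sum_mul, ← Finset.sum_div, hsq,
    ← hdrift] at hbonds
  simp only [add_mulVec, dotProduct_add, dotProduct_rateMatrix_mulVec,
    dotProduct_diagonal_mulVec_self, sum_sub_mul_occ]
  simp only [sub_mul, Finset.sum_sub_distrib]
  rw [← Finset.mul_sum _ _ (1 / 2 * ∑ x, h x ^ 2)]
  linarith

end DirichletForm

/-! ### Exponential moments along the exclusion process -/

section ExponentialMoment

open Matrix

variable {k : ℕ} {β : ℝ} {b : Fin k → ℝ} {N : ℕ}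

theorem measurable_eval (t : ℝ≥0) : Measurable fun ω : ConfigPath N => ω.1 t :=
  (measurable_pi_apply t).comp measurable_subtype_coe

variable [NeZero N]

theorem rateMatrix_nonneg {η ζ : Config N} (h : η ≠ ζ) : 0 ≤ rateMatrix β b N η ζ := by
  rw [rateMatrix, Matrix.smul_apply, LinearMap.toMatrix'_apply]
  have hsingle : (0 : Config N → ℝ) ≤ Pi.single ζ 1 := Pi.single_nonneg.2 zero_le_one
  refine mul_nonneg (by positivity) (Finset.sum_nonneg fun x _ => ?_)
  rw [Pi.single_eq_of_ne h, sub_zero]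
  exact mul_nonneg (conductance_nonneg x) (hsingle _)

open scoped Matrix.Norms.L2Operator

theorem transition_eq_exp (t : ℝ) (η ζ : Config N) :
    transition β b N t η ζ = NormedSpace.exp (t • rateMatrix β b N) η ζ := by
  let toMatrix : ((Config N → ℝ) →L[ℝ] (Config N → ℝ)) →+* Matrix (Config N) (Config N) ℝ :=
    (LinearMap.toMatrixAlgEquiv' (R := ℝ)).toRingEquiv.toRingHom.comp
      ContinuousLinearMap.toLinearMapRingHom
  have hcontinuous : Continuous toMatrix :=
    (LinearMap.toMatrix'.toLinearMap.comp
      (ContinuousLinearMap.coeLM ℝ)).continuous_of_finiteDimensional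
  have hgenerator : toMatrix ((t * (N : ℝ) ^ 2) • LinearMap.toContinuousLinearMap (generator β b N))
      = t • rateMatrix β b N := by
    rw [rateMatrix, smul_smul]
    exact map_smul LinearMap.toMatrix' (t * (N : ℝ) ^ 2) (generator β b N)
  let _ : NormedAlgebra ℚ ((Config N → ℝ) →L[ℝ] (Config N → ℝ)) := .restrictScalars ℚ ℝ _
  rw [← hgenerator, ← NormedSpace.map_exp toMatrix hcontinuous]
  exact (LinearMap.toMatrix'_apply _ η ζ).symm

theorem transition_nonneg {t : ℝ} (ht : 0 ≤ t) (η ζ : Config N) : 0 ≤ transition β b N t η ζ := by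
  rw [transition_eq_exp]
  exact exp_apply_nonneg_of_offDiag_nonneg
    (fun η ζ h => mul_nonneg ht (rateMatrix_nonneg h)) η ζ

theorem card_config : Fintype.card (Config N) = 2 ^ N := by
  rw [Fintype.card_fun, ZMod.card, Fintype.card_bool]

theorem lintegral_comp_eval {ι : Type*} [Fintype ι] [DecidableEq ι] (P : Measure (ConfigPath N))
    (s : ι → ℝ≥0) (f : (ι → Config N) → ℝ≥0∞) :
    ∫⁻ ω, f (fun i => ω.1 (s i)) ∂P = ∑ ζ, f ζ * P {ω | ∀ i, ω.1 (s i) = ζ i} := by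
  have heval : Measurable fun (ω : ConfigPath N) i => ω.1 (s i) :=
    measurable_pi_lambda _ fun i => measurable_eval (s i)
  rw [← lintegral_map (f := f) (measurable_of_finite f) heval, lintegral_fintype]
  refine Finset.sum_congr rfl fun ζ _ => ?_
  rw [Measure.map_apply heval (measurableSet_singleton ζ)]
  simp only [preimage, mem_singleton_iff, funext_iff]

theorem IsExclusionLaw.measure_grid_le {μ : Measure (Config N)} [IsProbabilityMeasure μ]
    {P : Measure (ConfigPath N)} (hP : IsExclusionLaw β b N μ P) (δ : ℝ≥0) {n : ℕ}
    (ζ : Fin (n + 1) → Config N) :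
    P {ω | ∀ i : Fin (n + 1), ω.1 (i * δ) = ζ i} ≤
      ENNReal.ofReal (∏ i : Fin n, transition β b N δ (ζ i.castSucc) (ζ i.succ)) := by
  let s : Fin (n + 1) → ℝ≥0 := fun i => i * δ
  have hmono : Monotone s := fun i j hij => by
    dsimp only [s]
    gcongr
    exact hij
  have hmesh : ∀ i : Fin n, (s i.succ : ℝ) - s i.castSucc = δ := fun i => by
    simp only [s, Fin.val_succ, Fin.val_castSucc, NNReal.coe_mul, NNReal.coe_natCast]
    push_cast
    ring
  have hnonneg : ∀ i ∈ Finset.univ, 0 ≤ transition β b N δ (ζ (Fin.castSucc i)) (ζ i.succ) :=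
    fun i _ => transition_nonneg δ.2 _ _
  refine (hP.finite_dim n s ζ hmono (by simp [s])).trans_le ?_
  simp only [hmesh, ENNReal.ofReal_prod_of_nonneg hnonneg]
  exact mul_le_of_le_one_left' prob_le_one

theorem IsExclusionLaw.lintegral_exp_sum_le {μ : Measure (Config N)} [IsProbabilityMeasure μ]
    {P : Measure (ConfigPath N)} (hP : IsExclusionLaw β b N μ P) (δ : ℝ≥0) {n : ℕ}
    (v : Fin n → Config N → ℝ) {r : ℝ} (hr : r ≤ 1) (hG : ‖(δ : ℝ) • rateMatrix β b N‖ ≤ r)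
    (hv : ∀ i, ‖v i‖ ≤ r)
    (hdiss : ∀ i a, a ⬝ᵥ ((δ : ℝ) • rateMatrix β b N + Matrix.diagonal (v i)) *ᵥ a ≤ 0) :
    ∫⁻ ω, ENNReal.ofReal (Real.exp (∑ i : Fin n, v i (ω.1 ((i + 1) * δ)))) ∂P ≤
      ENNReal.ofReal (2 ^ N * (1 + 10 * r ^ 2) ^ n) := by
  let f : (Fin (n + 1) → Config N) → ℝ≥0∞ := fun ζ =>
    ENNReal.ofReal (Real.exp (∑ i : Fin n, v i (ζ i.succ)))
  let p : (Fin (n + 1) → Config N) → ℝ := fun ζ =>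
    ∏ i : Fin n, transition β b N δ (ζ i.castSucc) (ζ i.succ)
  have hp : ∀ ζ, 0 ≤ p ζ := fun ζ => Finset.prod_nonneg fun i _ => transition_nonneg δ.2 _ _
  calc ∫⁻ ω, ENNReal.ofReal (Real.exp (∑ i : Fin n, v i (ω.1 ((i + 1) * δ)))) ∂P
      = ∑ ζ, f ζ * P {ω | ∀ i : Fin (n + 1), ω.1 (i * δ) = ζ i} := by
        rw [← lintegral_comp_eval P (fun i : Fin (n + 1) => i * δ) f]
        simp only [f, Fin.val_succ, Nat.cast_add, Nat.cast_one]
    _ ≤ ∑ ζ, f ζ * ENNReal.ofReal (p ζ) := by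
        gcongr with ζ
        exact hP.measure_grid_le δ ζ
    _ = ENNReal.ofReal (∑ ζ, p ζ * Real.exp (∑ i : Fin n, v i (ζ i.succ))) := by
        rw [ENNReal.ofReal_sum_of_nonneg fun ζ _ => mul_nonneg (hp ζ) (Real.exp_pos _).le]
        exact Finset.sum_congr rfl fun ζ _ => by rw [mul_comm, ENNReal.ofReal_mul (hp ζ)]
    _ ≤ ENNReal.ofReal (2 ^ N * (1 + 10 * r ^ 2) ^ n) := by
        refine ENNReal.ofReal_le_ofReal ?_
        simpa only [p, Real.exp_sum, ← Finset.prod_mul_distrib, transition_eq_exp, card_config,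
          Nat.cast_pow, Nat.cast_ofNat] using sum_path_exp_mul_exp_diagonal_le hG hv hr hdiss

end ExponentialMoment

/-! ### Riemann sums in time -/

section TimeGrid

variable {T : ℝ}

instance : IsFiniteMeasure (timeMeasure T) := by
  refine ⟨?_⟩
  rw [timeMeasure, (MeasurableEmbedding.subtype_coe measurableSet_Icc).comap_apply, image_univ,
    Subtype.range_coe]
  exact measure_Icc_lt_top

theorem timeMeasure_univ (T : ℝ) : timeMeasure T univ = ENNReal.ofReal T := by
  rw [timeMeasure, (MeasurableEmbedding.subtype_coe measurableSet_Icc).comap_apply, image_univ,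
    Subtype.range_coe, Real.volume_Icc, sub_zero]

theorem integral_timeMeasure (f : ℝ → ℝ) :
    ∫ t, f t ∂timeMeasure T = ∫ t in Icc 0 T, f t :=
  integral_subtype_comap measurableSet_Icc f

/-- The `j`-th point of the grid of mesh `T/n` in `[0,T]`; the last point `T` for `j > n`. -/
def gridPoint (hT : 0 ≤ T) (n j : ℕ) : Icc (0 : ℝ) T := projIcc 0 T hT (j * (T / n))

theorem coe_gridPoint (hT : 0 ≤ T) {n j : ℕ} (h : j ≤ n) :
    (gridPoint hT n j : ℝ) = j * (T / n) := by
  rw [gridPoint, coe_projIcc, min_eq_right, max_eq_right (by positivity)]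
  calc (j : ℝ) * (T / n) ≤ n * (T / n) := by gcongr
    _ ≤ T := by
        rw [← mul_div_assoc]
        exact div_le_of_le_mul₀ n.cast_nonneg hT (mul_comm _ _).le

/-- The first point of the grid of mesh `T/n` that does not precede `t`. -/
def gridCeil (hT : 0 ≤ T) (n : ℕ) (t : Icc (0 : ℝ) T) : Icc (0 : ℝ) T :=
  gridPoint hT n ⌈(t : ℝ) / (T / n)⌉₊

theorem coe_gridCeil (hT : 0 < T) {n : ℕ} (hn : 0 < n) (t : Icc (0 : ℝ) T) :
    (gridCeil hT.le n t : ℝ) = ⌈(t : ℝ) / (T / n)⌉₊ * (T / n) := by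
  refine coe_gridPoint hT.le (Nat.ceil_le.2 ?_)
  rw [div_le_iff₀ (by positivity), mul_div_cancel₀ _ (by positivity)]
  exact t.2.2

theorem le_gridCeil (hT : 0 < T) {n : ℕ} (hn : 0 < n) (t : Icc (0 : ℝ) T) :
    t ≤ gridCeil hT.le n t := by
  rw [← Subtype.coe_le_coe, coe_gridCeil hT hn, ← div_le_iff₀ (by positivity)]
  exact Nat.le_ceil _

theorem gridCeil_le_add (hT : 0 < T) {n : ℕ} (hn : 0 < n) (t : Icc (0 : ℝ) T) :
    (gridCeil hT.le n t : ℝ) ≤ t + T / n := by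
  have hceil := Nat.ceil_lt_add_one (div_nonneg t.2.1 (by positivity : 0 ≤ T / n))
  rw [coe_gridCeil hT hn]
  calc _ ≤ ((t : ℝ) / (T / n) + 1) * (T / n) := by gcongr
    _ = t + T / n := by rw [add_mul, one_mul, div_mul_cancel₀ _ (by positivity)]

theorem tendsto_gridCeil (hT : 0 < T) (t : Icc (0 : ℝ) T) :
    Tendsto (fun n => gridCeil hT.le n t) atTop (𝓝[≥] t) := by
  have hlow : ∀ᶠ n in atTop, t ≤ gridCeil hT.le n t :=
    (eventually_gt_atTop 0).mono fun n hn => le_gridCeil hT hn t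
  have hup : ∀ᶠ n in atTop, (gridCeil hT.le n t : ℝ) ≤ t + T / n :=
    (eventually_gt_atTop 0).mono fun n hn => gridCeil_le_add hT hn t
  have hbound : Tendsto (fun n : ℕ => (t : ℝ) + T / n) atTop (𝓝 t) := by
    simpa using tendsto_const_nhds.add (tendsto_const_div_atTop_nhds_zero_nat T)
  exact tendsto_nhdsWithin_iff.2 ⟨tendsto_subtype_rng.2
    (tendsto_of_tendsto_of_tendsto_of_le_of_le' tendsto_const_nhds hbound hlow hup), hlow⟩

theorem measurable_comp_gridCeil (hT : 0 ≤ T) (n : ℕ) {E : Type*} [MeasurableSpace E]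
    (f : Icc (0 : ℝ) T → E) : Measurable fun t => f (gridCeil hT n t) :=
  (measurable_from_nat (f := fun j => f (gridPoint hT n j))).comp
    (Nat.measurable_ceil.comp (measurable_subtype_coe.div_const _))

theorem measurable_of_continuousWithinAt_Ici (hT : 0 < T) {E : Type*} [TopologicalSpace E]
    [TopologicalSpace.PseudoMetrizableSpace E] [MeasurableSpace E] [BorelSpace E]
    {f : Icc (0 : ℝ) T → E} (hf : ∀ t, ContinuousWithinAt f (Ici t) t) : Measurable f :=
  measurable_of_tendsto_metrizable (fun n => measurable_comp_gridCeil hT.le n f)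
    (tendsto_pi_nhds.2 fun t => (hf t).tendsto.comp (tendsto_gridCeil hT t))

theorem integral_comp_gridCeil (hT : 0 < T) {n : ℕ} (hn : 0 < n) (f : Icc (0 : ℝ) T → ℝ) :
    ∫ t, f (gridCeil hT.le n t) ∂timeMeasure T
      = ∑ i : Fin n, T / n * f (gridPoint hT.le n (i + 1)) := by
  let F : ℝ → ℝ := fun t => f (gridPoint hT.le n ⌈t / (T / n)⌉₊)
  have hconst : ∀ i : ℕ, EqOn (fun _ => f (gridPoint hT.le n (i + 1))) F
      (uIoc ((i : ℝ) * (T / n)) (((i + 1 : ℕ) : ℝ) * (T / n))) := by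
    intro i t ht
    rw [uIoc_of_le (by gcongr; simp)] at ht
    have hceil : ⌈t / (T / n)⌉₊ = i + 1 := by
      rw [Nat.ceil_eq_iff (by simp), lt_div_iff₀ (by positivity), div_le_iff₀ (by positivity)]
      exact ⟨by simpa using ht.1, ht.2⟩
    simp only [F, hceil]
  have hinterval : ∫ t, f (gridCeil hT.le n t) ∂timeMeasure T = ∫ t in (0 : ℝ)..T, F t := by
    rw [intervalIntegral.integral_of_le hT.le, ← integral_Icc_eq_integral_Ioc,
      ← integral_timeMeasure]
    rfl
  have hsum := intervalIntegral.sum_integral_adjacent_intervals (f := F) (μ := volume)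
    (a := fun i : ℕ => (i : ℝ) * (T / n)) (n := n) fun i _ =>
      (intervalIntegrable_congr (hconst i)).1 intervalIntegrable_const
  simp only [Nat.cast_zero, zero_mul, mul_div_cancel₀ T (Nat.cast_ne_zero.2 hn.ne')] at hsum
  rw [hinterval, ← hsum, Finset.sum_range]
  refine Finset.sum_congr rfl fun i _ => ?_
  rw [← intervalIntegral.integral_congr_ae (Eventually.of_forall fun x hx => hconst i hx),
    intervalIntegral.integral_const, smul_eq_mul]
  push_cast
  ring

theorem tendsto_riemannSum_of_continuousWithinAt_Ici (hT : 0 < T) {f : Icc (0 : ℝ) T → ℝ}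
    (hf : ∀ t, ContinuousWithinAt f (Ici t) t) {C : ℝ} (hC : ∀ t, ‖f t‖ ≤ C) :
    Tendsto (fun n : ℕ => ∑ i : Fin n, T / n * f (gridPoint hT.le n (i + 1))) atTop
      (𝓝 (∫ t, f t ∂timeMeasure T)) := by
  have hstep : ∀ᶠ n in atTop, ∫ t, f (gridCeil hT.le n t) ∂timeMeasure T
      = ∑ i : Fin n, T / n * f (gridPoint hT.le n (i + 1)) :=
    (eventually_gt_atTop 0).mono fun n hn => integral_comp_gridCeil hT hn f
  refine Tendsto.congr' hstep ?_
  exact tendsto_integral_of_dominated_convergence (fun _ => C)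
    (fun n => (measurable_comp_gridCeil hT.le n f).aestronglyMeasurable)
    (integrable_const _) (fun n => .of_forall fun t => hC _)
    (.of_forall fun t => (hf t).tendsto.comp (tendsto_gridCeil hT t))

end TimeGrid

section ExponentialMoment

open Matrix
open scoped Matrix.Norms.L2Operator

variable {T : ℝ} {k : ℕ} {β : ℝ} {b : Fin k → ℝ} {N : ℕ} [NeZero N] {μ : Measure (Config N)}
  {P : Measure (ConfigPath N)}

/-- A time in `[0,T]`, seen as a point of the time half-line on which the process is defined. -/
def toTime (t : Icc (0 : ℝ) T) : ℝ≥0 := ⟨t, t.2.1⟩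

theorem continuous_toTime : Continuous (toTime (T := T)) :=
  continuous_subtype_val.subtype_mk _

theorem toTime_gridPoint (hT : 0 ≤ T) {n j : ℕ} (h : j ≤ n) :
    toTime (gridPoint hT n j) = j * (T / n).toNNReal := by
  ext
  rw [NNReal.coe_mul, NNReal.coe_natCast, Real.coe_toNNReal _ (by positivity)]
  exact coe_gridPoint hT h

theorem continuousWithinAt_comp_configPath {w : Icc (0 : ℝ) T → Config N → ℝ}
    (hw : ∀ η, Continuous fun t => w t η) (ω : ConfigPath N) (t : Icc (0 : ℝ) T) :
    ContinuousWithinAt (fun t => w t (ω.1 (toTime t))) (Ici t) t := by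
  have hpath : Tendsto (fun t => ω.1 (toTime t)) (𝓝[≥] t) (𝓝 (ω.1 (toTime t))) :=
    (ω.2 (toTime t)).1.comp continuous_toTime.continuousWithinAt fun s hs => hs
  rw [nhds_discrete, tendsto_pure] at hpath
  refine (((hw (ω.1 (toTime t))).tendsto t).mono_left nhdsWithin_le_nhds).congr' ?_
  filter_upwards [hpath] with s hs
  rw [hs]

theorem IsExclusionLaw.lintegral_exp_riemannSum_le [IsProbabilityMeasure μ]
    (hP : IsExclusionLaw β b N μ P) (hT : 0 ≤ T) {w : Icc (0 : ℝ) T → Config N → ℝ} {R : ℝ}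
    (hG : ‖rateMatrix β b N‖ ≤ R) (hR : ∀ t, ‖w t‖ ≤ R)
    (hw : ∀ t a, a ⬝ᵥ (rateMatrix β b N + Matrix.diagonal (w t)) *ᵥ a ≤ 0) {n : ℕ}
    (hn : T / n * R ≤ 1) :
    ∫⁻ ω, ENNReal.ofReal (Real.exp (∑ i : Fin n,
        T / n * w (gridPoint hT n (i + 1)) (ω.1 (toTime (gridPoint hT n (i + 1)))))) ∂P
      ≤ ENNReal.ofReal (2 ^ N * (1 + 10 * (T / n * R) ^ 2) ^ n) := by
  have hδ : 0 ≤ T / n := by positivity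
  have hcoe : (((T / n).toNNReal : ℝ≥0) : ℝ) = T / n := Real.coe_toNNReal _ hδ
  have hnorm : ∀ {E : Type} [SeminormedAddCommGroup E] [NormedSpace ℝ E] {x : E}, ‖x‖ ≤ R →
      ‖(T / n) • x‖ ≤ T / n * R := fun hx => by
    rw [norm_smul, Real.norm_of_nonneg hδ]
    gcongr
  have hgrid : ∀ i : Fin n, toTime (gridPoint hT n (i + 1)) = (i + 1) * (T / n).toNNReal :=
    fun i => by
      rw [toTime_gridPoint hT (Nat.succ_le_of_lt i.2), Nat.cast_succ]
  simp only [hgrid]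
  refine hP.lintegral_exp_sum_le (T / n).toNNReal
    (fun i η => T / n * w (gridPoint hT n (i + 1)) η) hn ?_ (fun i => hnorm (hR _)) fun i a => ?_
  · rw [hcoe]
    exact hnorm hG
  · have hscale : (T / n) • rateMatrix β b N
        + Matrix.diagonal (fun η => T / n * w (gridPoint hT n (i + 1)) η)
        = (T / n) • (rateMatrix β b N + Matrix.diagonal (w (gridPoint hT n (i + 1)))) := by
      rw [smul_add, ← diagonal_smul]
      rfl
    rw [hcoe, hscale, smul_mulVec, dotProduct_smul]
    exact mul_nonpos_of_nonneg_of_nonpos hδ (hw _ a)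

theorem tendsto_one_add_sq_div_pow (c : ℝ) :
    Tendsto (fun n : ℕ => (1 + c ^ 2 / (n : ℝ) ^ 2) ^ n) atTop (𝓝 1) := by
  have hexp : Tendsto (fun n : ℕ => Real.exp (c ^ 2 / n)) atTop (𝓝 1) := by
    simpa using (tendsto_const_div_atTop_nhds_zero_nat (c ^ 2)).rexp
  refine tendsto_of_tendsto_of_tendsto_of_le_of_le tendsto_const_nhds hexp
    (fun n => one_le_pow₀ (le_add_of_nonneg_right (by positivity))) fun n => ?_
  calc (1 + c ^ 2 / (n : ℝ) ^ 2) ^ n ≤ Real.exp (c ^ 2 / (n : ℝ) ^ 2) ^ n := by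
        gcongr
        rw [add_comm]
        exact Real.add_one_le_exp _
    _ = Real.exp (c ^ 2 / n) := by
        rw [← Real.exp_nat_mul]
        congr 1
        rcases n.eq_zero_or_pos with rfl | hn
        · simp
        · field_simp

theorem IsExclusionLaw.lintegral_exp_integral_le [IsProbabilityMeasure μ]
    (hP : IsExclusionLaw β b N μ P) (hT : 0 < T) {w : Icc (0 : ℝ) T → Config N → ℝ}
    (hc : ∀ η, Continuous fun t => w t η)
    (hw : ∀ t a, a ⬝ᵥ (rateMatrix β b N + Matrix.diagonal (w t)) *ᵥ a ≤ 0) :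
    ∫⁻ ω, ENNReal.ofReal (Real.exp (∫ t, w t (ω.1 (toTime t)) ∂timeMeasure T)) ∂P
      ≤ ENNReal.ofReal (2 ^ N) := by
  obtain ⟨C, hC⟩ := isCompact_univ.exists_bound_of_continuousOn (continuous_pi hc).continuousOn
  let R := max ‖rateMatrix β b N‖ C
  have hR : ∀ t, ‖w t‖ ≤ R := fun t => (hC t (mem_univ t)).trans (le_max_right _ _)
  let F : ℕ → ConfigPath N → ℝ := fun n ω => ∑ i : Fin n,
    T / n * w (gridPoint hT.le n (i + 1)) (ω.1 (toTime (gridPoint hT.le n (i + 1))))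
  have hFmeas : ∀ n, Measurable (F n) := fun n => Finset.measurable_sum _ fun i _ =>
    ((measurable_of_finite _).comp (measurable_eval _)).const_mul _
  have hFlim : ∀ ω, Tendsto (fun n => F n ω) atTop
      (𝓝 (∫ t, w t (ω.1 (toTime t)) ∂timeMeasure T)) := fun ω =>
    tendsto_riemannSum_of_continuousWithinAt_Ici hT (continuousWithinAt_comp_configPath hc ω)
      fun t => (norm_le_pi_norm (w t) _).trans (hR t)
  have hmesh : Tendsto (fun n : ℕ => T / n * R) atTop (𝓝 0) := by
    simpa using (tendsto_const_div_atTop_nhds_zero_nat T).mul_const R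
  have hbound : Tendsto (fun n : ℕ => ENNReal.ofReal (2 ^ N * (1 + 10 * (T / n * R) ^ 2) ^ n)) atTop
      (𝓝 (ENNReal.ofReal (2 ^ N))) := by
    have hpow := (tendsto_one_add_sq_div_pow (√10 * (T * R))).const_mul (2 ^ N : ℝ)
    simp only [mul_pow, Real.sq_sqrt (Nat.ofNat_nonneg 10), mul_one] at hpow
    refine ENNReal.tendsto_ofReal (hpow.congr fun n => ?_)
    ring
  calc ∫⁻ ω, ENNReal.ofReal (Real.exp (∫ t, w t (ω.1 (toTime t)) ∂timeMeasure T)) ∂P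
      = ∫⁻ ω, liminf (fun n => ENNReal.ofReal (Real.exp (F n ω))) atTop ∂P :=
        lintegral_congr fun ω => (ENNReal.tendsto_ofReal (hFlim ω).rexp).liminf_eq.symm
    _ ≤ liminf (fun n => ∫⁻ ω, ENNReal.ofReal (Real.exp (F n ω)) ∂P) atTop :=
        lintegral_liminf_le fun n => (hFmeas n).exp.ennreal_ofReal
    _ ≤ liminf (fun n : ℕ => ENNReal.ofReal (2 ^ N * (1 + 10 * (T / n * R) ^ 2) ^ n)) atTop := by
        refine liminf_le_liminf ((hmesh.eventually (ge_mem_nhds one_pos)).mono fun n hn => ?_)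
        exact hP.lintegral_exp_riemannSum_le hT.le (le_max_left _ _) hR hw hn
    _ = ENNReal.ofReal (2 ^ N) := hbound.liminf_eq

end ExponentialMoment

/-! ### Sub-probability measures on the torus -/

namespace SubProb

theorem measure_univ_le (ν : SubProb) : ν.toMeasure univ ≤ 1 := by
  rw [toMeasure, ← FiniteMeasure.ennreal_mass]
  exact_mod_cast ν.2

instance (ν : SubProb) : IsFiniteMeasure ν.toMeasure :=
  ⟨ν.measure_univ_le.trans_lt ENNReal.one_lt_top⟩

theorem integrable (ν : SubProb) (f : C(UnitAddCircle, ℝ)) : Integrable f ν.toMeasure :=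
  (BoundedContinuousFunction.mkOfCompact f).integrable _

theorem abs_pairing_le (ν : SubProb) (f : C(UnitAddCircle, ℝ)) : |ν.pairing f| ≤ ‖f‖ := by
  calc |ν.pairing f| ≤ ‖f‖ * ν.toMeasure.real univ :=
        norm_integral_le_of_norm_le_const (.of_forall f.norm_coe_le_norm)
    _ ≤ ‖f‖ * 1 := by
        gcongr
        exact ENNReal.toReal_le_of_le_ofReal zero_le_one (by simpa using ν.measure_univ_le)
    _ = ‖f‖ := mul_one _

theorem dist_pairing_le (ν : SubProb) (f g : C(UnitAddCircle, ℝ)) :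
    dist (ν.pairing f) (ν.pairing g) ≤ dist f g := by
  have hsub : ν.pairing f - ν.pairing g = ν.pairing (f - g) :=
    (integral_sub (ν.integrable f) (ν.integrable g)).symm
  rw [Real.dist_eq, hsub, dist_eq_norm]
  exact ν.abs_pairing_le _

theorem uniformContinuous_pairing (f : C(UnitAddCircle, ℝ)) :
    UniformContinuous fun ν : SubProb => ν.pairing f :=
  have hpairing : UniformContinuous pairing := by
    change Tendsto _ (comap _ _) _
    exact tendsto_comap
  (Pi.uniformContinuous_proj (fun _ : C(UnitAddCircle, ℝ) => ℝ) f).comp hpairing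

theorem uniformity_eq_iInf_comap : uniformity SubProb =
    ⨅ f : C(UnitAddCircle, ℝ), comap (fun p : SubProb × SubProb => (p.1.pairing f, p.2.pairing f))
      (uniformity ℝ) := by
  change comap (fun p : SubProb × SubProb => (p.1.pairing, p.2.pairing))
    (uniformity (C(UnitAddCircle, ℝ) → ℝ)) = _
  simp only [Pi.uniformity, comap_iInf, comap_comap, Function.comp_def]

/-- The integrals of a dense sequence of continuous functions. They determine the uniform structure
of `SubProb`, which is therefore countably generated. -/
def denseEval (ν : SubProb) (i : ℕ) : ℝ :=
  ν.pairing (TopologicalSpace.denseSeq C(UnitAddCircle, ℝ) i)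

theorem isUniformInducing_denseEval : IsUniformInducing denseEval := by
  have huc : UniformContinuous denseEval :=
    uniformContinuous_pi.2 fun i => uniformContinuous_pairing _
  refine ⟨le_antisymm (α := Filter (SubProb × SubProb)) ?_ (tendsto_iff_comap.1 huc)⟩
  rw [uniformity_eq_iInf_comap]
  refine le_iInf fun f => ?_
  rw [← tendsto_iff_comap, Metric.uniformity_basis_dist.tendsto_right_iff]
  intro ε hε
  obtain ⟨i, hi⟩ := Metric.denseRange_iff.1
    (TopologicalSpace.denseRange_denseSeq C(UnitAddCircle, ℝ)) f (ε / 3) (by positivity)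
  have hclose : {p : (ℕ → ℝ) × (ℕ → ℝ) | dist (p.1 i) (p.2 i) < ε / 3} ∈ uniformity (ℕ → ℝ) :=
    Pi.uniformContinuous_proj (fun _ : ℕ => ℝ) i (Metric.dist_mem_uniformity (by positivity))
  filter_upwards [preimage_mem_comap hclose] with p hp
  calc dist (p.1.pairing f) (p.2.pairing f)
      ≤ dist (p.1.pairing f) (p.1.denseEval i) + dist (p.1.denseEval i) (p.2.denseEval i)
        + dist (p.2.denseEval i) (p.2.pairing f) := dist_triangle4 _ _ _ _
    _ < ε / 3 + ε / 3 + ε / 3 := by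
        gcongr
        · exact (p.1.dist_pairing_le _ _).trans_lt hi
        · exact hp
        · exact (p.2.dist_pairing_le _ _).trans_lt (dist_comm f _ ▸ hi)
    _ = ε := by ring

instance : IsCountablyGenerated (uniformity SubProb) := by
  rw [← isUniformInducing_denseEval.comap_uniformity]
  infer_instance

theorem continuous_pairing :
    Continuous fun p : SubProb × C(UnitAddCircle, ℝ) => p.1.pairing p.2 :=
  continuous_prod_of_continuous_lipschitzWith' _ 1
    (fun ν => LipschitzWith.mk_one ν.dist_pairing_le)
    fun f => (uniformContinuous_pairing f).continuous

end SubProb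

/-! ### Càdlàg paths and the Skorohod topology -/

theorem IsCadlag.comp {ι E F : Type*} [TopologicalSpace ι] [Preorder ι] [TopologicalSpace E]
    [TopologicalSpace F] {x : ι → E} (hx : IsCadlag x) {f : E → F} (hf : Continuous f) :
    IsCadlag fun t => f (x t) := fun t =>
  ⟨(hf.tendsto _).comp (hx t).1, (hx t).2.elim fun l hl => ⟨f l, (hf.tendsto l).comp hl⟩⟩

section Cadlag

variable {ι : Type*} [LinearOrder ι] [TopologicalSpace ι] [OrderTopology ι]
  [SecondCountableTopology ι]

theorem countable_of_eventually_nhdsLT_notMem {s : Set ι} (hs : ∀ t ∈ s, ∀ᶠ r in 𝓝[<] t, r ∉ s) :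
    s.Countable := by
  refine .mono (fun t ht => ?_) (countable_setOfPred_isolated_left_within (s := s))
  refine ⟨ht, ?_⟩
  rw [← empty_mem_iff_bot, inter_comm, nhdsWithin_inter']
  filter_upwards [mem_inf_of_left (hs t ht), mem_inf_of_right (mem_principal_self s)]
    with r hr hrs using hr hrs

/-- At a jump time, a rational strictly separates the left limit from the value, and the times
separated by a given rational in a given order are isolated from the left. -/
theorem IsCadlag.countable_not_continuousAt {x : ι → ℝ} (hx : IsCadlag x) :
    {t | ¬ContinuousAt x t}.Countable := by
  choose hright l hl using hx
  have hcover : {t | ¬ContinuousAt x t} ⊆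
      ⋃ q : ℚ, ({t | l t < q ∧ (q : ℝ) < x t} ∪ {t | (q : ℝ) < l t ∧ x t < q}) := by
    intro t ht
    have hjump : l t ≠ x t := fun heq =>
      ht <| by
        rw [ContinuousAt, ← nhdsLT_sup_nhdsGE]
        exact Tendsto.sup (heq ▸ hl t) (hright t)
    rcases hjump.lt_or_gt with hlt | hgt
    · obtain ⟨q, hlq, hqx⟩ := exists_rat_btwn hlt
      exact mem_iUnion.2 ⟨q, Or.inl ⟨hlq, hqx⟩⟩
    · obtain ⟨q, hxq, hql⟩ := exists_rat_btwn hgt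
      exact mem_iUnion.2 ⟨q, Or.inr ⟨hql, hxq⟩⟩
  refine (countable_iUnion fun q => Countable.union ?_ ?_).mono hcover <;>
    refine countable_of_eventually_nhdsLT_notMem fun t ht => ?_
  · filter_upwards [(hl t).eventually (gt_mem_nhds ht.1)] with s hs hmem
    exact lt_asymm hs hmem.2
  · filter_upwards [(hl t).eventually (lt_mem_nhds ht.1)] with s hs hmem
    exact lt_asymm hs hmem.2

theorem SubProb.countable_not_continuousAt {x : ι → SubProb} (hx : IsCadlag x) :
    {t | ¬ContinuousAt x t}.Countable := by
  have hcoord (i : ℕ) : {t | ¬ContinuousAt (fun t => (x t).denseEval i) t}.Countable :=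
    (hx.comp (uniformContinuous_pairing _).continuous).countable_not_continuousAt
  refine (countable_iUnion hcoord).mono fun t ht => ?_
  by_contra hcont
  simp only [mem_iUnion, mem_ofPred_eq, not_exists, not_not] at hcont
  exact ht (isUniformInducing_denseEval.isInducing.continuousAt_iff.2 (continuousAt_pi.2 hcont))

end Cadlag

section Skorohod

variable {T : ℝ} {E : Type*} [UniformSpace E]

theorem hasBasis_uniformity_skorohodSpace (T : ℝ) (E : Type*) [UniformSpace E] :
    (uniformity (SkorohodSpace T E)).HasBasis
      (fun p : ℝ × Set (E × E) => 0 < p.1 ∧ p.2 ∈ uniformity E)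
      fun p => skorohodRel p.1 p.2 := by
  refine ⟨fun S => (skorohodBasis T E).mem_filter_iff.trans ⟨?_, ?_⟩⟩
  · rintro ⟨_, ⟨ε, hε, V, hV, rfl⟩, hS⟩
    exact ⟨(ε, V), ⟨hε, hV⟩, hS⟩
  · rintro ⟨⟨ε, V⟩, ⟨hε, hV⟩, hS⟩
    exact ⟨_, ⟨ε, hε, V, hV, rfl⟩, hS⟩

theorem skorohodRel_mono {ε ε' : ℝ} {V V' : Set (E × E)}
    (hε : ε ≤ ε') (hV : V ⊆ V') :
    (skorohodRel ε V : Set (SkorohodSpace T E × SkorohodSpace T E)) ⊆ skorohodRel ε' V' := by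
  rintro p ⟨r, hr, hmem⟩
  exact ⟨r, fun t => (hr t).trans hε, fun t => hV (hmem t)⟩

instance [IsCountablyGenerated (uniformity E)] :
    IsCountablyGenerated (uniformity (SkorohodSpace T E)) := by
  obtain ⟨V, hV⟩ := (uniformity E).exists_antitone_basis
  have hbasis : (uniformity (SkorohodSpace T E)).HasBasis (fun _ : ℕ => True)
      fun n => skorohodRel (1 / ((n : ℝ) + 1)) (V n) := by
    refine (hasBasis_uniformity_skorohodSpace T E).to_hasBasis ?_ fun n _ =>
      ⟨(_, _), ⟨by positivity, hV.1.mem_of_mem trivial⟩, Subset.rfl⟩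
    rintro ⟨ε, W⟩ ⟨hε, hW⟩
    obtain ⟨n, hn⟩ := exists_nat_one_div_lt hε
    obtain ⟨m, -, hm⟩ := hV.1.mem_iff.1 hW
    refine ⟨max n m, trivial, skorohodRel_mono ?_ ((hV.2 (le_max_right n m)).trans hm)⟩
    refine le_trans ?_ hn.le
    gcongr
    exact le_max_left n m
  exact (⟨hbasis, to_countable _⟩ : HasCountableBasis _ _ _).isCountablyGenerated

theorem SkorohodSpace.eventually_mem_skorohodRel (x : SkorohodSpace T E) {ε : ℝ} (hε : 0 < ε)
    {V : Set (E × E)} (hV : V ∈ uniformity E) : ∀ᶠ y in 𝓝 x, (x, y) ∈ skorohodRel ε V :=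
  Uniform.tendsto_nhds_right.1 tendsto_id
    ((hasBasis_uniformity_skorohodSpace T E).mem_of_mem (i := (ε, V)) ⟨hε, hV⟩)

theorem SkorohodSpace.tendsto_apply (x : SkorohodSpace T E) {t : Icc (0 : ℝ) T}
    (ht : ContinuousAt x.1 t) :
    Tendsto (fun y : SkorohodSpace T E => y.1 t) (𝓝 x) (𝓝 (x.1 t)) := by
  refine Uniform.tendsto_nhds_right.2 fun V hV => ?_
  obtain ⟨W, hW, hWV⟩ := comp_mem_uniformity_sets hV
  obtain ⟨ε, hε, hball⟩ :=
    Metric.nhds_basis_closedBall.mem_iff.1 (Uniform.continuousAt_iff'_right.1 ht hW)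
  refine (x.eventually_mem_skorohodRel hε hW).mono fun y ⟨r, hr, hmem⟩ => ?_
  exact hWV ⟨x.1 (r t), hball (by simpa [Subtype.dist_eq, Real.dist_eq] using hr t), hmem t⟩

theorem isClosed_setOf_forall_pairing_le (T : ℝ) (f : C(UnitAddCircle, ℝ)) (c : ℝ) :
    IsClosed {π : SkorohodSpace T SubProb | ∀ t, (π.1 t).pairing f ≤ c} := by
  refine isClosed_of_closure_subset fun π hπ t => le_of_forall_pos_le_add fun ε hε => ?_
  have hV : {p : SubProb × SubProb | dist (p.1.pairing f) (p.2.pairing f) < ε}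
      ∈ uniformity SubProb :=
    SubProb.uniformContinuous_pairing f (Metric.dist_mem_uniformity hε)
  obtain ⟨y, ⟨r, -, hdist⟩, hy⟩ :=
    mem_closure_iff_nhds.1 hπ _ (π.eventually_mem_skorohodRel one_pos hV)
  have hdist_t : dist ((π.1 (r (r.symm t))).pairing f) ((y.1 (r.symm t)).pairing f) < ε :=
    hdist (r.symm t)
  rw [OrderIso.apply_symm_apply, Real.dist_eq] at hdist_t
  linarith [le_abs_self ((π.1 t).pairing f - (y.1 (r.symm t)).pairing f), hy (r.symm t)]

end Skorohod

section TimePairing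

variable {T : ℝ}

/-- The space-time integral `∫₀ᵀ ∫ h(t,u) π_t(du) dt` of `h` along the path of measures `π`. -/
def timePairing (h : C(Cylinder T, ℝ)) (π : SkorohodSpace T SubProb) : ℝ :=
  ∫ t, (π.1 t).pairing (h.curry t) ∂timeMeasure T

theorem norm_curry_le {X Y : Type*} [TopologicalSpace X] [CompactSpace X] [TopologicalSpace Y]
    [CompactSpace Y] (h : C(X × Y, ℝ)) (x : X) : ‖h.curry x‖ ≤ ‖h‖ :=
  (ContinuousMap.norm_le _ (norm_nonneg _)).2 fun y => h.norm_coe_le_norm (x, y)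

theorem norm_pairing_curry_le (h : C(Cylinder T, ℝ)) (ν : SubProb) (t : Icc (0 : ℝ) T) :
    ‖ν.pairing (h.curry t)‖ ≤ ‖h‖ :=
  (ν.abs_pairing_le _).trans (norm_curry_le h t)

theorem measurable_pairing_curry (hT : 0 < T) (h : C(Cylinder T, ℝ)) (π : SkorohodSpace T SubProb) :
    Measurable fun t => (π.1 t).pairing (h.curry t) :=
  measurable_of_continuousWithinAt_Ici hT fun t =>
    (SubProb.continuous_pairing.tendsto (π.1 t, h.curry t)).comp
      ((π.2 t).1.prodMk (h.curry.continuous.continuousWithinAt (s := Ici t) (x := t)))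

theorem integrable_pairing_curry (hT : 0 < T) (h : C(Cylinder T, ℝ))
    (π : SkorohodSpace T SubProb) :
    Integrable (fun t => (π.1 t).pairing (h.curry t)) (timeMeasure T) :=
  (integrable_const ‖h‖).mono' (measurable_pairing_curry hT h π).aestronglyMeasurable
    (.of_forall fun t => norm_pairing_curry_le h (π.1 t) t)

instance : NullSingletonClass (timeMeasure T) := by
  refine ⟨fun t => ?_⟩
  rw [timeMeasure, (MeasurableEmbedding.subtype_coe measurableSet_Icc).comap_apply, image_singleton,
    Real.volume_singleton]

theorem continuous_timePairing (hT : 0 < T) (h : C(Cylinder T, ℝ)) :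
    Continuous (timePairing h) := by
  refine continuous_iff_continuousAt.2 fun π => ?_
  have hcont : ∀ᵐ t ∂timeMeasure T, ContinuousAt π.1 t :=
    (SubProb.countable_not_continuousAt π.2).measure_zero _
  refine tendsto_integral_filter_of_dominated_convergence (fun _ => ‖h‖)
    (.of_forall fun y => (measurable_pairing_curry hT h y).aestronglyMeasurable)
    (.of_forall fun y => .of_forall fun t => norm_pairing_curry_le h (y.1 t) t)
    (integrable_const _) ?_
  filter_upwards [hcont] with t ht
  exact (SubProb.continuous_pairing.tendsto (π.1 t, h.curry t)).comp
    ((π.tendsto_apply ht).prodMk_nhds tendsto_const_nhds)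

theorem abs_timePairing_le (hT : 0 ≤ T) (h : C(Cylinder T, ℝ)) (π : SkorohodSpace T SubProb) :
    |timePairing h π| ≤ T * ‖h‖ := by
  have hbound := norm_integral_le_of_norm_le_const (μ := timeMeasure T)
    (.of_forall fun t => norm_pairing_curry_le h (π.1 t) t)
  rwa [measureReal_def, timeMeasure_univ, ENNReal.toReal_ofReal hT, mul_comm] at hbound

end TimePairing

/-! ### Riemann sums on the torus -/

instance : IsProbabilityMeasure (volume : Measure UnitAddCircle) := ⟨UnitAddCircle.measure_univ⟩

theorem exists_norm_sub_toAddCircle_le (N : ℕ) [NeZero N] (u : UnitAddCircle) :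
    ∃ x : ZMod N, ‖u - ZMod.toAddCircle x‖ ≤ 1 / N := by
  have hN : (0 : ℝ) < N := by exact_mod_cast NeZero.pos N
  obtain ⟨r, rfl⟩ := QuotientAddGroup.mk_surjective u
  refine ⟨(⌊r * N⌋ : ℤ), ?_⟩
  rw [ZMod.toAddCircle_intCast]
  calc ‖((r - ⌊r * N⌋ / N : ℝ) : UnitAddCircle)‖
      ≤ |r - ⌊r * N⌋ / N| := QuotientAddGroup.norm_mk_le_norm
    _ = Int.fract (r * N) / N := by
        rw [← abs_of_nonneg (Int.fract_nonneg (r * N)), ← abs_of_pos hN, ← abs_div, abs_of_pos hN,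
          Int.fract]
        congr 1
        field_simp
    _ ≤ 1 / N := by
        gcongr
        exact (Int.fract_lt_one _).le

theorem eventually_one_div_pnat_lt {ε : ℝ} (hε : 0 < ε) : ∀ᶠ N : ℕ+ in atTop, 1 / (N : ℝ) < ε :=
  (tendsto_one_div_atTop_nhds_zero_nat.comp tendsto_PNat_val_atTop_atTop).eventually
    (gt_mem_nhds hε)

/-- The average of `h` over the lattice of mesh `1/N` shifted by `u`. Averaging it further over `u`
gives `∫ h`, which compares Riemann sums with integrals. -/
def latticeAverage (N : ℕ) [NeZero N] (h : UnitAddCircle → ℝ) (u : UnitAddCircle) : ℝ :=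
  (1 / (N : ℝ)) * ∑ x : ZMod N, h (u + ZMod.toAddCircle x)

section LatticeAverage

variable (N : ℕ) [NeZero N]

theorem integrable_latticeAverage (h : C(UnitAddCircle, ℝ)) : Integrable (latticeAverage N h) := by
  refine Continuous.integrable_of_hasCompactSupport ?_ (.of_compactSpace _)
  unfold latticeAverage
  fun_prop

theorem integral_latticeAverage (h : C(UnitAddCircle, ℝ)) :
    ∫ u, latticeAverage N h u = ∫ u, h u := by
  have hint (x : ZMod N) : Integrable fun u => h (u + ZMod.toAddCircle x) :=
    Continuous.integrable_of_hasCompactSupport (by fun_prop) (.of_compactSpace _)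
  have hN : (N : ℝ) ≠ 0 := NeZero.ne _
  unfold latticeAverage
  rw [integral_const_mul, integral_finsetSum _ fun x _ => hint x]
  simp only [integral_add_right_eq_self (fun u => h u), Finset.sum_const, Finset.card_univ,
    ZMod.card, nsmul_eq_mul]
  field_simp

theorem latticeAverage_sub_toAddCircle (h : UnitAddCircle → ℝ) (u : UnitAddCircle) (y : ZMod N) :
    latticeAverage N h (u - ZMod.toAddCircle y) = latticeAverage N h u := by
  simp only [latticeAverage]
  rw [← Equiv.sum_comp (Equiv.addLeft y)]
  simp only [Equiv.coe_addLeft, AddMonoidHom.map_add, ← add_assoc, sub_add_cancel]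

theorem abs_latticeAverage_sub_le {h : UnitAddCircle → ℝ} {ε : ℝ} {u v : UnitAddCircle}
    (huv : ∀ w, |h (u + w) - h (v + w)| ≤ ε) :
    |latticeAverage N h u - latticeAverage N h v| ≤ ε := by
  have hN : (N : ℝ) ≠ 0 := NeZero.ne _
  rw [latticeAverage, latticeAverage, ← mul_sub, ← Finset.sum_sub_distrib, abs_mul,
    abs_of_nonneg (by positivity)]
  calc 1 / (N : ℝ) * |∑ x : ZMod N, (h (u + ZMod.toAddCircle x) - h (v + ZMod.toAddCircle x))|
      ≤ 1 / (N : ℝ) * ∑ _x : ZMod N, ε := by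
        gcongr
        exact (Finset.abs_sum_le_sum_abs _ _).trans (Finset.sum_le_sum fun x _ => huv _)
    _ = ε := by
        rw [Finset.sum_const, Finset.card_univ, ZMod.card, nsmul_eq_mul]
        field_simp

end LatticeAverage

theorem tendsto_riemannSum_unitAddCircle (h : C(UnitAddCircle, ℝ)) :
    Tendsto (fun N : ℕ+ => (1 / (N : ℝ)) * ∑ x : ZMod N, h (ZMod.toAddCircle x)) atTop
      (𝓝 (∫ u, h u)) := by
  rw [Metric.tendsto_nhds]
  intro ε hε
  obtain ⟨δ, hδ, huc⟩ := Metric.uniformContinuous_iff.1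
    (CompactSpace.uniformContinuous_of_continuous h.continuous) (ε / 2) (by positivity)
  filter_upwards [eventually_one_div_pnat_lt hδ] with N hN
  have hosc (u : UnitAddCircle) : ‖latticeAverage N h 0 - latticeAverage N h u‖ ≤ ε / 2 := by
    obtain ⟨y, hy⟩ := exists_norm_sub_toAddCircle_le N u
    rw [← latticeAverage_sub_toAddCircle N h u y]
    refine abs_latticeAverage_sub_le N fun w => (huc ?_).le
    rw [dist_add_right, dist_zero_left]
    exact hy.trans_lt hN
  have hdiff : latticeAverage N h 0 - ∫ u, h u
      = ∫ u, (latticeAverage N h 0 - latticeAverage N h u) := by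
    rw [integral_sub (integrable_const _) (integrable_latticeAverage N h), integral_latticeAverage,
      integral_const, probReal_univ, one_smul]
  have hbound := norm_integral_le_of_norm_le_const
    (μ := (volume : Measure UnitAddCircle)) (.of_forall hosc)
  rw [← hdiff, probReal_univ, mul_one] at hbound
  simpa [latticeAverage, Real.dist_eq] using hbound.trans_lt (half_lt_self hε)

theorem pairing_empirical {N : ℕ} [NeZero N] (η : Config N) (f : C(UnitAddCircle, ℝ)) :
    (empirical η).pairing f = (1 / (N : ℝ)) * ∑ x : ZMod N, f (ZMod.toAddCircle x) * occ η x := by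
  change ∫ u, f u ∂empiricalMeasure η = _
  rw [empiricalMeasure, integral_smul_measure, integral_finsetSum_measure]
  · simp only [ENNReal.toReal_inv, ENNReal.toReal_natCast, smul_eq_mul, one_div]
    congr 1
    refine Finset.sum_congr rfl fun x _ => ?_
    by_cases hx : η x <;> simp [hx, occ]
  · intro x _
    split_ifs
    · exact (BoundedContinuousFunction.mkOfCompact f).integrable _
    · exact integrable_zero_measure

/-! ### Exponential moments of the energy functionals -/

section TestFunctions

variable {T : ℝ} {B : Set UnitAddCircle}

namespace TorusTest

/-- The test function `H` as an element of `C([0,T] × 𝕋)`. -/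
def toContinuousMap (φ : TorusTest T B) : C(Cylinder T, ℝ) := ⟨φ.H, φ.continuous_H⟩

/-- The space derivative `∂_u H` as an element of `C([0,T] × 𝕋)`. -/
def deriv (φ : TorusTest T B) : C(Cylinder T, ℝ) := ⟨φ.dH, φ.continuous_dH⟩

/-- The difference quotient `(t,u) ↦ N (H(t, u + 1/N) - H(t,u))`, the lattice approximation of
`∂_u H`. -/
def discreteDeriv (φ : TorusTest T B) (N : ℕ) : C(Cylinder T, ℝ) where
  toFun p := N * (φ.H (p.1, p.2 + ((1 / N : ℝ) : UnitAddCircle)) - φ.H p)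
  continuous_toFun := by
    have := φ.continuous_H
    fun_prop

theorem exists_discreteDeriv_eq_deriv (φ : TorusTest T B) (N : ℕ+) (t : Icc (0 : ℝ) T) (r : ℝ) :
    ∃ s ∈ Ioo r (r + 1 / (N : ℝ)), φ.discreteDeriv N (t, (r : UnitAddCircle)) = φ.deriv (t, s) := by
  have hN : (0 : ℝ) < (N : ℕ) := by exact_mod_cast N.pos
  obtain ⟨s, hs, hslope⟩ := exists_hasDerivAt_eq_slope
    (fun v : ℝ => φ.H (t, (v : UnitAddCircle))) (fun v : ℝ => φ.dH (t, (v : UnitAddCircle)))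
    (lt_add_of_pos_right r (one_div_pos.2 hN))
    (fun v _ => (φ.hasDerivAt t v).continuousAt.continuousWithinAt)
    fun v _ => φ.hasDerivAt t v
  refine ⟨s, hs, ?_⟩
  simp only [discreteDeriv, deriv, ContinuousMap.coe_mk, hslope, AddCircle.coe_add,
    add_sub_cancel_left, div_div_eq_mul_div, div_one, mul_comm]

theorem eventually_norm_discreteDeriv_sub_deriv_le (φ : TorusTest T B) {ε : ℝ} (hε : 0 < ε) :
    ∀ᶠ N : ℕ+ in atTop, ‖φ.discreteDeriv N - φ.deriv‖ ≤ ε := by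
  obtain ⟨δ, hδ, huc⟩ := Metric.uniformContinuous_iff.1
    (CompactSpace.uniformContinuous_of_continuous φ.continuous_dH) ε hε
  filter_upwards [eventually_one_div_pnat_lt hδ] with N hN
  refine (ContinuousMap.norm_le _ hε.le).2 fun ⟨t, u⟩ => ?_
  obtain ⟨r, rfl⟩ := QuotientAddGroup.mk_surjective u
  obtain ⟨s, hs, hderiv⟩ := φ.exists_discreteDeriv_eq_deriv N t r
  have hnear : ‖((s - r : ℝ) : UnitAddCircle)‖ < δ := by
    refine (QuotientAddGroup.norm_mk_le_norm (S := AddSubgroup.zmultiples (1 : ℝ))).trans_lt ?_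
    rw [Real.norm_of_nonneg (sub_nonneg.2 hs.1.le)]
    linarith [hs.2]
  refine le_of_eq_of_le (congrArg (‖· - φ.deriv (t, (r : UnitAddCircle))‖) hderiv) ?_
  rw [← dist_eq_norm]
  refine (huc ?_).le
  rwa [Prod.dist_eq, dist_self, max_eq_right dist_nonneg, dist_eq_norm, ← AddCircle.coe_sub]

end TorusTest

theorem toAddCircle_add_one {N : ℕ} [NeZero N] (x : ZMod N) :
    ZMod.toAddCircle (x + 1) = ZMod.toAddCircle x + ((1 / N : ℝ) : UnitAddCircle) := by
  rw [map_add]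
  congr 1
  simpa using ZMod.toAddCircle_natCast (N := N) 1

theorem IsSlow.exists_dist_toAddCircle_le {k N : ℕ} [NeZero N] {b : Fin k → ℝ} {x : ZMod N}
    (hx : IsSlow b x) : ∃ i, dist (ZMod.toAddCircle (x + 1)) (b i : UnitAddCircle) ≤ 1 / N := by
  obtain ⟨i, r, hr, hri⟩ := hx
  refine ⟨i, ?_⟩
  rw [← hri, toAddCircle_add_one, ZMod.toAddCircle_apply, ← AddCircle.coe_add, dist_eq_norm,
    ← AddCircle.coe_sub]
  refine (QuotientAddGroup.norm_mk_le_norm (S := AddSubgroup.zmultiples (1 : ℝ))).trans ?_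
  rw [← add_div, Real.norm_of_nonneg (sub_nonneg.2 hr.2)]
  linarith [hr.1, add_div (x.val : ℝ) 1 N]

theorem TorusTest.eventually_eq_zero_of_isSlow {k : ℕ} {b : Fin k → ℝ}
    (φ : TorusTest T (slowPoints b)) :
    ∀ᶠ N : ℕ+ in atTop, ∀ t, ∀ x : ZMod N, IsSlow b x → φ.H (t, ZMod.toAddCircle (x + 1)) = 0 := by
  have hclosed : IsClosed (Prod.snd '' tsupport φ.H) :=
    ((isClosed_tsupport φ.H).isCompact.image continuous_snd).isClosed
  have hball (i : Fin k) :
      ∃ δ > 0, Metric.ball (b i : UnitAddCircle) δ ⊆ (Prod.snd '' tsupport φ.H)ᶜ := by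
    refine Metric.isOpen_iff.1 hclosed.isOpen_compl _ ?_
    rintro ⟨p, hp, hpi⟩
    exact (φ.support hp).2 ⟨i, hpi.symm⟩
  choose δ hδ hball using hball
  filter_upwards [eventually_all.2 fun i => eventually_one_div_pnat_lt (hδ i)] with N hN t x hx
  obtain ⟨i, hi⟩ := hx.exists_dist_toAddCircle_le
  exact image_eq_zero_of_notMem_tsupport fun hmem =>
    hball i (Metric.mem_ball.2 (hi.trans_lt (hN i))) ⟨_, hmem, rfl⟩

/-- The functional `π ↦ ∫₀ᵀ ∫ ∂_u H dπ_t dt - 2 ∫₀ᵀ ∫ H² du dt`, whose supremum over `H` is the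
energy of the path `π`. -/
def TorusTest.functional (φ : TorusTest T B) (π : SkorohodSpace T SubProb) : ℝ :=
  timePairing φ.deriv π - 2 * ∫ p, φ.H p ^ 2 ∂cylinderMeasure T

instance : IsFiniteMeasure (cylinderMeasure T) := by
  unfold cylinderMeasure
  infer_instance

theorem integrable_cylinder {f : Cylinder T → ℝ} (hf : Continuous f) :
    Integrable f (cylinderMeasure T) :=
  hf.integrable_of_hasCompactSupport (.of_compactSpace _)

theorem timePairing_sub (hT : 0 < T) (h h' : C(Cylinder T, ℝ)) (π : SkorohodSpace T SubProb) :
    timePairing (h - h') π = timePairing h π - timePairing h' π := by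
  rw [timePairing, timePairing, timePairing,
    ← integral_sub (integrable_pairing_curry hT h π) (integrable_pairing_curry hT h' π)]
  exact integral_congr_ae (.of_forall fun t =>
    integral_sub ((π.1 t).integrable (h.curry t)) ((π.1 t).integrable (h'.curry t)))

namespace TorusTest

/-- The profile `u ↦ ∫₀ᵀ H(t,u)² dt`. -/
def sqProfile (φ : TorusTest T B) : C(UnitAddCircle, ℝ) where
  toFun u := ∫ t, φ.H (t, u) ^ 2 ∂timeMeasure T
  continuous_toFun := by
    have := φ.continuous_H
    simpa using continuous_parametric_integral_of_continuous (μ := timeMeasure T)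
      (f := fun (u : UnitAddCircle) (t : Icc (0 : ℝ) T) => φ.H (t, u) ^ 2) (s := univ)
      (by fun_prop) isCompact_univ

theorem integral_sqProfile (φ : TorusTest T B) :
    ∫ u, φ.sqProfile u = ∫ p, φ.H p ^ 2 ∂cylinderMeasure T :=
  (integral_prod_symm _ (integrable_cylinder (φ.continuous_H.pow 2))).symm

/-- The time-dependent potential `N ∑ₓ (H(t,(x+1)/N) - H(t,x/N)) η(x) - ½ ∑ₓ H(t,x/N)²`: its time
integral along the process is the microscopic counterpart of `N * φ.functional`. -/
def potential (φ : TorusTest T B) (N : ℕ) [NeZero N] (t : Icc (0 : ℝ) T) (η : Config N) : ℝ :=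
  N * ∑ x : ZMod N,
      (φ.H (t, ZMod.toAddCircle (x + 1)) - φ.H (t, ZMod.toAddCircle x)) * occ η x
    - 1 / 2 * ∑ x : ZMod N, φ.H (t, ZMod.toAddCircle x) ^ 2

theorem continuous_potential (φ : TorusTest T B) (N : ℕ) [NeZero N] (η : Config N) :
    Continuous fun t => φ.potential N t η := by
  have := φ.continuous_H
  unfold potential
  fun_prop

theorem potential_eq (φ : TorusTest T B) (N : ℕ) [NeZero N] (t : Icc (0 : ℝ) T) (η : Config N) :
    φ.potential N t η = N * (empirical η).pairing ((φ.discreteDeriv N).curry t)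
      - 1 / 2 * ∑ x : ZMod N, φ.H (t, ZMod.toAddCircle x) ^ 2 := by
  have hN : (N : ℝ) ≠ 0 := NeZero.ne _
  rw [pairing_empirical, ← mul_assoc, mul_one_div_cancel hN, one_mul, potential, Finset.mul_sum]
  simp only [toAddCircle_add_one, ← mul_assoc]
  rfl

theorem integral_potential_eq (hT : 0 < T) (φ : TorusTest T B) (N : ℕ) [NeZero N]
    (ω : ConfigPath N) :
    ∫ t, φ.potential N t (ω.1 (toTime t)) ∂timeMeasure T
      = N * timePairing (φ.discreteDeriv N) (empiricalPath N T ω)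
        - 1 / 2 * ∑ x : ZMod N, φ.sqProfile (ZMod.toAddCircle x) := by
  have hpointwise (t : Icc (0 : ℝ) T) : φ.potential N t (ω.1 (toTime t))
      = N * ((empiricalPath N T ω).1 t).pairing ((φ.discreteDeriv N).curry t)
        - 1 / 2 * ∑ x : ZMod N, φ.H (t, ZMod.toAddCircle x) ^ 2 := φ.potential_eq N t _
  have hsq (x : ZMod N) :
      Integrable (fun t => φ.H (t, ZMod.toAddCircle x) ^ 2) (timeMeasure T) := by
    have := φ.continuous_H
    exact Continuous.integrable_of_hasCompactSupport (by fun_prop) (.of_compactSpace _)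
  simp only [hpointwise]
  rw [integral_sub ((integrable_pairing_curry hT _ _).const_mul _)
    ((integrable_finsetSum _ fun x _ => hsq x).const_mul _), integral_const_mul,
    integral_const_mul, integral_finsetSum _ fun x _ => hsq x]
  rfl

theorem eventually_mul_functional_le (hT : 0 < T) (φ : TorusTest T B) {ε : ℝ} (hε : 0 < ε) :
    ∀ᶠ N : ℕ+ in atTop, ∀ ω : ConfigPath N, N * φ.functional (empiricalPath N T ω) ≤
      ∫ t, φ.potential N t (ω.1 (toTime t)) ∂timeMeasure T + N * ε := by
  have hriemann := (tendsto_riemannSum_unitAddCircle φ.sqProfile).eventually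
    (gt_mem_nhds (lt_add_of_pos_right _ hε))
  filter_upwards [hriemann,
    φ.eventually_norm_discreteDeriv_sub_deriv_le (show 0 < ε / (2 * T) by positivity)]
    with N hsum hderiv ω
  have hN : (0 : ℝ) < (N : ℕ) := by exact_mod_cast N.pos
  have hpairing : timePairing φ.deriv (empiricalPath N T ω) ≤
      timePairing (φ.discreteDeriv N) (empiricalPath N T ω) + ε / 2 := by
    have hdiff := abs_timePairing_le hT.le (φ.discreteDeriv N - φ.deriv) (empiricalPath N T ω)
    rw [timePairing_sub hT] at hdiff
    have : T * ‖φ.discreteDeriv N - φ.deriv‖ ≤ ε / 2 :=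
      calc T * ‖φ.discreteDeriv N - φ.deriv‖ ≤ T * (ε / (2 * T)) := by gcongr
        _ = ε / 2 := by field_simp
    linarith [neg_le_of_abs_le hdiff]
  have hsq : 0 ≤ ∫ u, φ.sqProfile u :=
    integral_nonneg fun u => integral_nonneg fun t => sq_nonneg _
  rw [one_div_mul_eq_div, div_lt_iff₀ hN] at hsum
  rw [φ.integral_potential_eq hT, functional, ← φ.integral_sqProfile]
  nlinarith [mul_le_mul_of_nonneg_left hpairing hN.le, mul_nonneg hN.le hsq]

theorem eventually_lintegral_exp_functional_le {k : ℕ} {β : ℝ} {b : Fin k → ℝ} (hT : 0 < T)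
    {μ : ∀ N : ℕ+, Measure (Config N)} [∀ N, IsProbabilityMeasure (μ N)]
    {P : ∀ N : ℕ+, Measure (ConfigPath N)} (hP : ∀ N : ℕ+, IsExclusionLaw β b N (μ N) (P N))
    (φ : TorusTest T (slowPoints b)) {ε : ℝ} (hε : 0 < ε) :
    ∀ᶠ N : ℕ+ in atTop,
      ∫⁻ ω, ENNReal.ofReal (Real.exp (N * φ.functional (empiricalPath N T ω))) ∂P N
        ≤ ENNReal.ofReal (Real.exp (N * (Real.log 2 + ε))) := by
  filter_upwards [φ.eventually_mul_functional_le hT hε, φ.eventually_eq_zero_of_isSlow]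
    with N hfunctional hslow
  calc ∫⁻ ω, ENNReal.ofReal (Real.exp (N * φ.functional (empiricalPath N T ω))) ∂P N
      ≤ ∫⁻ ω, ENNReal.ofReal
            (Real.exp (∫ t, φ.potential N t (ω.1 (toTime t)) ∂timeMeasure T)) *
          ENNReal.ofReal (Real.exp (N * ε)) ∂P N := by
        refine lintegral_mono fun ω => ?_
        rw [← ENNReal.ofReal_mul (Real.exp_pos _).le, ← Real.exp_add]
        gcongr
        exact hfunctional ω
    _ = (∫⁻ ω, ENNReal.ofReal
            (Real.exp (∫ t, φ.potential N t (ω.1 (toTime t)) ∂timeMeasure T)) ∂P N) *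
          ENNReal.ofReal (Real.exp (N * ε)) := lintegral_mul_const' _ _ ENNReal.ofReal_ne_top
    _ ≤ ENNReal.ofReal (2 ^ (N : ℕ)) * ENNReal.ofReal (Real.exp (N * ε)) := by
        gcongr
        exact (hP N).lintegral_exp_integral_le hT (φ.continuous_potential N)
          fun t => dotProduct_rateMatrix_add_discreteDerivative_nonpos
            (h := fun x => φ.H (t, ZMod.toAddCircle x)) (hslow t)
    _ = ENNReal.ofReal (Real.exp (N * (Real.log 2 + ε))) := by
        rw [← ENNReal.ofReal_mul (by positivity), mul_add, Real.exp_add,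
          Real.exp_nat_mul (Real.log 2), Real.exp_log two_pos]

end TorusTest

end TestFunctions

/-! ### The expected energy of a limit point -/

theorem integrable_finset_sup' {Ω ι : Type*} {m : MeasurableSpace Ω} {ν : Measure Ω} {s : Finset ι}
    (hs : s.Nonempty) {F : ι → Ω → ℝ} (hF : ∀ i ∈ s, Integrable (F i) ν) :
    Integrable (fun ω => s.sup' hs fun i => F i ω) ν := by
  simpa only [← Finset.sup'_apply] using Finset.sup'_induction hs F
    (p := fun f => Integrable f ν) (fun _ hf _ hg => hf.sup hg) hF

/-- Jensen's inequality combined with `exp (max F) ≤ ∑ exp F`. -/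
theorem integral_sup'_le_of_lintegral_exp_le {Ω ι : Type*} {m : MeasurableSpace Ω} {ν : Measure Ω}
    [IsProbabilityMeasure ν] {s : Finset ι} (hs : s.Nonempty) {F : ι → Ω → ℝ}
    (hF : ∀ i ∈ s, Integrable (F i) ν) {a L : ℝ} (ha : 0 < a)
    (hexp : ∀ i ∈ s, ∫⁻ ω, ENNReal.ofReal (Real.exp (a * F i ω)) ∂ν
      ≤ ENNReal.ofReal (Real.exp L)) :
    ∫ ω, s.sup' hs (fun i => F i ω) ∂ν ≤ (Real.log s.card + L) / a := by
  set G : Ω → ℝ := fun ω => s.sup' hs fun i => F i ω with hGdef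
  have hG : Integrable G ν := integrable_finset_sup' hs hF
  have hexpF (i) (hi : i ∈ s) : Integrable (fun ω => Real.exp (a * F i ω)) ν :=
    (lintegral_ofReal_ne_top_iff_integrable
      (Real.continuous_exp.comp_aestronglyMeasurable ((hF i hi).const_mul a).1)
      (.of_forall fun _ => (Real.exp_pos _).le)).1
      ((hexp i hi).trans_lt ENNReal.ofReal_lt_top).ne
  have hexpG_le (ω) : Real.exp (a * G ω) ≤ ∑ i ∈ s, Real.exp (a * F i ω) := by
    obtain ⟨i, hi, hmax⟩ := s.exists_mem_eq_sup' hs fun i => F i ω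
    simp only [hGdef, hmax]
    exact Finset.single_le_sum (f := fun i => Real.exp (a * F i ω))
      (fun _ _ => (Real.exp_pos _).le) hi
  have hexpG : Integrable (fun ω => Real.exp (a * G ω)) ν :=
    (integrable_finsetSum s hexpF).mono'
      (Real.continuous_exp.comp_aestronglyMeasurable (hG.const_mul a).1)
      (.of_forall fun ω => (Real.norm_of_nonneg (Real.exp_pos _).le).trans_le (hexpG_le ω))
  have hmoment : ∫ ω, Real.exp (a * G ω) ∂ν ≤ s.card * Real.exp L :=
    calc ∫ ω, Real.exp (a * G ω) ∂ν ≤ ∫ ω, ∑ i ∈ s, Real.exp (a * F i ω) ∂ν :=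
          integral_mono hexpG (integrable_finsetSum s hexpF) hexpG_le
      _ = ∑ i ∈ s, ∫ ω, Real.exp (a * F i ω) ∂ν := integral_finsetSum s hexpF
      _ ≤ ∑ _i ∈ s, Real.exp L := by
          refine Finset.sum_le_sum fun i hi => ?_
          rw [← ENNReal.ofReal_le_ofReal_iff (Real.exp_pos _).le,
            ofReal_integral_eq_lintegral_ofReal (hexpF i hi)
              (.of_forall fun _ => (Real.exp_pos _).le)]
          exact hexp i hi
      _ = s.card * Real.exp L := by rw [Finset.sum_const, nsmul_eq_mul]
  have hjensen : Real.exp (∫ ω, a * G ω ∂ν) ≤ ∫ ω, Real.exp (a * G ω) ∂ν :=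
    convexOn_exp.map_integral_le Real.continuous_exp.continuousOn isClosed_univ
      (.of_forall fun _ => mem_univ _) (hG.const_mul a) hexpG
  have hcard : (0 : ℝ) < s.card := by exact_mod_cast hs.card_pos
  rw [le_div_iff₀' ha, ← integral_const_mul, ← Real.log_exp L,
    ← Real.log_mul hcard.ne' (Real.exp_pos _).ne', Real.le_log_iff_exp_le (by positivity)]
  exact hjensen.trans hmoment

theorem integral_le_of_mapClusterPt {Ω ι : Type*} [TopologicalSpace Ω] [MeasurableSpace Ω]
    [OpensMeasurableSpace Ω] {l : Filter ι} {Q : ι → ProbabilityMeasure Ω}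
    {Q₀ : ProbabilityMeasure Ω} (hQ₀ : MapClusterPt Q₀ l Q) (Ψ : BoundedContinuousFunction Ω ℝ)
    {c : ℝ} (h : ∀ ε > 0, ∀ᶠ i in l, ∫ ω, Ψ ω ∂(Q i : Measure Ω) ≤ c + ε) :
    ∫ ω, Ψ ω ∂(Q₀ : Measure Ω) ≤ c :=
  le_of_forall_pos_le_add fun ε hε => (isClosed_le
    (ProbabilityMeasure.continuous_integral_boundedContinuousFunction Ψ)
    continuous_const).mem_of_mapClusterPt hQ₀ (h ε hε)

section ExpectedEnergy

variable {T : ℝ} {B : Set UnitAddCircle}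

namespace TorusTest

instance : Zero (TorusTest T B) where
  zero :=
    { H := 0
      dH := 0
      continuous_H := continuous_const
      continuous_dH := continuous_const
      hasDerivAt := fun _ u => hasDerivAt_const u 0
      support := by simp [tsupport] }

theorem functional_zero (π : SkorohodSpace T SubProb) :
    (0 : TorusTest T B).functional π = 0 := by
  have hderiv : (0 : TorusTest T B).deriv = 0 := rfl
  have hH (p) : (0 : TorusTest T B).H p = 0 := rfl
  have hcurry (t) : (0 : C(Cylinder T, ℝ)).curry t = 0 := rfl
  simp [functional, hderiv, hH, hcurry, timePairing, SubProb.pairing]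

theorem continuous_functional (hT : 0 < T) (φ : TorusTest T B) : Continuous φ.functional :=
  (continuous_timePairing hT _).sub continuous_const

/-- The functional of a test function as a bounded continuous function on the Skorohod space. -/
def boundedFunctional (hT : 0 < T) (φ : TorusTest T B) :
    BoundedContinuousFunction (SkorohodSpace T SubProb) ℝ :=
  .ofNormedAddCommGroup φ.functional (φ.continuous_functional hT)
    (T * ‖φ.deriv‖ + |2 * ∫ p, φ.H p ^ 2 ∂cylinderMeasure T|) fun π =>
      (abs_sub _ _).trans (add_le_add_left (abs_timePairing_le hT.le _ π) _)

theorem integrable_functional (hT : 0 < T) (φ : TorusTest T B)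
    (Q : Measure (SkorohodSpace T SubProb)) [IsFiniteMeasure Q] : Integrable φ.functional Q :=
  (φ.boundedFunctional hT).integrable Q

end TorusTest

theorem continuous_integral_cylinder :
    Continuous fun h : C(Cylinder T, ℝ) => ∫ p, h p ∂cylinderMeasure T := by
  refine (LipschitzWith.of_dist_le_mul (K := ((cylinderMeasure T).real univ).toNNReal)
    fun h h' => ?_).continuous
  rw [Real.dist_eq, dist_eq_norm, Real.coe_toNNReal _ measureReal_nonneg,
    ← integral_sub (integrable_cylinder h.continuous) (integrable_cylinder h'.continuous), mul_comm]
  exact norm_integral_le_of_norm_le_const (.of_forall fun p => (h - h').norm_coe_le_norm p)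

theorem continuous_timePairing_left (hT : 0 < T) (π : SkorohodSpace T SubProb) :
    Continuous fun h : C(Cylinder T, ℝ) => timePairing h π := by
  refine (LipschitzWith.of_dist_le_mul (K := T.toNNReal) fun h h' => ?_).continuous
  rw [Real.dist_eq, dist_eq_norm, Real.coe_toNNReal _ hT.le, ← timePairing_sub hT]
  exact abs_timePairing_le hT.le _ π

/-- The energy of a path of measures, defined without reference to a density; it agrees with
`energy` when the path has one. -/
def pathEnergy (B : Set UnitAddCircle) (π : SkorohodSpace T SubProb) : ℝ≥0∞ :=
  ⨆ φ : TorusTest T B, ENNReal.ofReal (φ.functional π)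

theorem measurable_pathEnergy (hT : 0 < T) :
    Measurable (pathEnergy B : SkorohodSpace T SubProb → ℝ≥0∞) :=
  (lowerSemicontinuous_iSup fun φ : TorusTest T B =>
    (ENNReal.continuous_ofReal.comp (φ.continuous_functional hT)).lowerSemicontinuous).measurable

theorem exists_seq_pathEnergy_eq (hT : 0 < T) (B : Set UnitAddCircle) :
    ∃ ψ : ℕ → TorusTest T B, ∀ π : SkorohodSpace T SubProb,
      pathEnergy B π = ⨆ n, ENNReal.ofReal ((ψ n).functional π) := by
  let toC (φ : TorusTest T B) : C(Cylinder T, ℝ) × C(Cylinder T, ℝ) := (φ.toContinuousMap, φ.deriv)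
  let _ : TopologicalSpace (TorusTest T B) := .induced toC inferInstance
  have htoC : Continuous toC := continuous_induced_dom
  have : SecondCountableTopology (TorusTest T B) :=
    TopologicalSpace.secondCountableTopology_induced _ _ toC
  have hfunctional (π : SkorohodSpace T SubProb) :
      Continuous fun φ : TorusTest T B => φ.functional π :=
    ((continuous_timePairing_left hT π).comp (continuous_snd.comp htoC)).sub
      (continuous_const.mul (continuous_integral_cylinder.comp ((continuous_fst.comp htoC).pow 2)))
  have hdense : Dense (range (TopologicalSpace.denseSeq (TorusTest T B))) :=
    TopologicalSpace.denseRange_denseSeq _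
  exact ⟨TopologicalSpace.denseSeq _, fun π =>
    (hdense.ciSup' (ENNReal.continuous_ofReal.comp (hfunctional π))).symm.trans
      (iSup_range' (fun φ : TorusTest T B => ENNReal.ofReal (φ.functional π)) _)⟩

variable {k : ℕ} {β : ℝ} {b : Fin k → ℝ} {μ : ∀ N : ℕ+, Measure (Config N)}
  [∀ N, IsProbabilityMeasure (μ N)] {P : ∀ N : ℕ+, Measure (ConfigPath N)}
  {Q : ℕ+ → ProbabilityMeasure (SkorohodSpace T SubProb)}
  {Q₀ : ProbabilityMeasure (SkorohodSpace T SubProb)}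

theorem eventually_integral_sup'_functional_le (hT : 0 < T)
    (hP : ∀ N : ℕ+, IsExclusionLaw β b N (μ N) (P N))
    (hQ : ∀ N : ℕ+, HasLaw (empiricalPath N T) (Q N : Measure (SkorohodSpace T SubProb)) (P N))
    (s : Finset (TorusTest T (slowPoints b))) (hs : s.Nonempty) {ε : ℝ} (hε : 0 < ε) :
    ∀ᶠ N : ℕ+ in atTop,
      ∫ π, s.sup' hs (fun φ => φ.functional π) ∂(Q N : Measure (SkorohodSpace T SubProb))
        ≤ Real.log 2 + ε := by
  have hcard : ∀ᶠ N : ℕ+ in atTop, Real.log s.card / (N : ℝ) < ε / 2 :=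
    ((tendsto_const_div_atTop_nhds_zero_nat (Real.log s.card)).comp
      tendsto_PNat_val_atTop_atTop).eventually (gt_mem_nhds (half_pos hε))
  have hmeas (N : ℕ+) (φ : TorusTest T (slowPoints b)) :
      Measurable fun π => ENNReal.ofReal (Real.exp (N * φ.functional π)) :=
    ((φ.continuous_functional hT).measurable.const_mul _).exp.ennreal_ofReal
  filter_upwards [hcard, (Finset.eventually_all s).2 fun φ (_ : φ ∈ s) =>
    φ.eventually_lintegral_exp_functional_le hT hP (half_pos hε)] with N hcard hexp
  have hN : (0 : ℝ) < (N : ℕ) := by exact_mod_cast N.pos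
  calc ∫ π, s.sup' hs (fun φ => φ.functional π) ∂(Q N : Measure (SkorohodSpace T SubProb))
      ≤ (Real.log s.card + N * (Real.log 2 + ε / 2)) / (N : ℕ) := by
        refine integral_sup'_le_of_lintegral_exp_le hs (fun φ _ => φ.integrable_functional hT _) hN
          fun φ hφ => ?_
        rw [← (hQ N).lintegral_comp (hmeas N φ).aemeasurable]
        exact hexp φ hφ
    _ ≤ Real.log 2 + ε := by
        rw [add_div, mul_div_cancel_left₀ _ hN.ne']
        linarith

theorem integral_sup'_functional_le (hT : 0 < T)
    (hP : ∀ N : ℕ+, IsExclusionLaw β b N (μ N) (P N))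
    (hQ : ∀ N : ℕ+, HasLaw (empiricalPath N T) (Q N : Measure (SkorohodSpace T SubProb)) (P N))
    (hQ₀ : MapClusterPt Q₀ atTop Q) (s : Finset (TorusTest T (slowPoints b))) (hs : s.Nonempty) :
    ∫ π, s.sup' hs (fun φ => φ.functional π) ∂(Q₀ : Measure (SkorohodSpace T SubProb))
      ≤ Real.log 2 := by
  have hsup (π) : s.sup' hs (TorusTest.boundedFunctional hT) π
      = s.sup' hs fun φ => φ.functional π :=
    Finset.apply_sup'_eq_sup'_comp hs
      (fun Ψ : BoundedContinuousFunction (SkorohodSpace T SubProb) ℝ => Ψ π) fun _ _ => rfl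
  simpa only [hsup] using integral_le_of_mapClusterPt hQ₀
    (s.sup' hs (TorusTest.boundedFunctional hT)) fun ε hε => by
      simpa only [hsup] using eventually_integral_sup'_functional_le hT hP hQ s hs hε

/-- The test function `0` is adjoined to a finite family so that the maximum is nonnegative. -/
theorem lintegral_pathEnergy_le (hT : 0 < T)
    (hP : ∀ N : ℕ+, IsExclusionLaw β b N (μ N) (P N))
    (hQ : ∀ N : ℕ+, HasLaw (empiricalPath N T) (Q N : Measure (SkorohodSpace T SubProb)) (P N))
    (hQ₀ : MapClusterPt Q₀ atTop Q) :
    ∫⁻ π, pathEnergy (slowPoints b) π ∂(Q₀ : Measure (SkorohodSpace T SubProb))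
      ≤ ENNReal.ofReal (Real.log 2) := by
  classical
  obtain ⟨ψ, hψ⟩ := exists_seq_pathEnergy_eq hT (slowPoints b)
  have hmeas (i) : Measurable fun π => ENNReal.ofReal ((ψ i).functional π) :=
    ((ψ i).continuous_functional hT).measurable.ennreal_ofReal
  simp_rw [hψ, iSup_eq_iSup_finset fun i => ENNReal.ofReal ((ψ i).functional _)]
  rw [lintegral_iSup_directed_of_measurable
    (fun t : Finset ℕ => .iSup fun i => .iSup_Prop (i ∈ t) (hmeas i))
    (directed_of_isDirected_le fun _ _ htt' π => biSup_mono fun _ => Finset.mem_of_subset htt')]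
  refine iSup_le fun t => ?_
  set s : Finset (TorusTest T (slowPoints b)) := insert 0 (t.image ψ)
  have hs : s.Nonempty := Finset.insert_nonempty _ _
  have hnonneg (π : SkorohodSpace T SubProb) : 0 ≤ s.sup' hs fun φ => φ.functional π :=
    (TorusTest.functional_zero π).symm.le.trans
      (Finset.le_sup' (fun φ : TorusTest T (slowPoints b) => φ.functional π)
        (Finset.mem_insert_self 0 (t.image ψ)))
  calc ∫⁻ π, ⨆ i ∈ t, ENNReal.ofReal ((ψ i).functional π) ∂(Q₀ : Measure (SkorohodSpace T SubProb))
      ≤ ∫⁻ π, ENNReal.ofReal (s.sup' hs fun φ => φ.functional π)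
          ∂(Q₀ : Measure (SkorohodSpace T SubProb)) :=
        lintegral_mono fun π => iSup₂_le fun i hi => ENNReal.ofReal_le_ofReal
          (Finset.le_sup' (fun φ : TorusTest T (slowPoints b) => φ.functional π)
            (Finset.mem_insert_of_mem (Finset.mem_image_of_mem ψ hi)))
    _ = ENNReal.ofReal (∫ π, s.sup' hs (fun φ => φ.functional π)
          ∂(Q₀ : Measure (SkorohodSpace T SubProb))) :=
        (ofReal_integral_eq_lintegral_ofReal
          (integrable_finset_sup' hs fun φ _ => φ.integrable_functional hT _)
          (.of_forall hnonneg)).symm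
    _ ≤ ENNReal.ofReal (Real.log 2) :=
        ENNReal.ofReal_le_ofReal (integral_sup'_functional_le hT hP hQ hQ₀ s hs)

end ExpectedEnergy

/-! ### Densities of the limiting paths -/

theorem ae_mem_of_mapClusterPt {Ω ι : Type*} [TopologicalSpace Ω] [MeasurableSpace Ω]
    [OpensMeasurableSpace Ω] [HasOuterApproxClosed Ω] {l : Filter ι} {Q : ι → ProbabilityMeasure Ω}
    {Q₀ : ProbabilityMeasure Ω} (hQ₀ : MapClusterPt Q₀ l Q) {F : Set Ω} (hF : IsClosed F)
    (h : ∀ᶠ i in l, ∀ᵐ ω ∂(Q i : Measure Ω), ω ∈ F) : ∀ᵐ ω ∂(Q₀ : Measure Ω), ω ∈ F := by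
  obtain ⟨U, hU, hQU⟩ := mapClusterPt_iff_ultrafilter.1 hQ₀
  have hfull : (fun i => (Q i : Measure Ω) F) =ᶠ[U] fun _ => 1 :=
    hU (h.mono fun i hi => (mem_ae_iff_prob_eq_one hF.measurableSet).1 hi)
  refine (mem_ae_iff_prob_eq_one hF.measurableSet).2 (le_antisymm prob_le_one ?_)
  calc (1 : ℝ≥0∞) = limsup (fun i => (Q i : Measure Ω) F) U := by
        rw [limsup_congr hfull, limsup_const]
    _ ≤ (Q₀ : Measure Ω) F := ProbabilityMeasure.limsup_measure_closed_le_of_tendsto hQU hF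

theorem measure_le_of_forall_lintegral_le {Ω : Type*} [TopologicalSpace Ω] [MeasurableSpace Ω]
    [BorelSpace Ω] [HasOuterApproxClosed Ω] {μ ν : Measure Ω} [IsFiniteMeasure μ] [μ.WeaklyRegular]
    [IsFiniteMeasure ν]
    (h : ∀ f : BoundedContinuousFunction Ω ℝ≥0, ∫⁻ ω, f ω ∂μ ≤ ∫⁻ ω, f ω ∂ν) : μ ≤ ν := by
  have hclosed (F : Set Ω) (hF : IsClosed F) : μ F ≤ ν F :=
    ge_of_tendsto (HasOuterApproxClosed.tendsto_lintegral_apprSeq hF ν) <| .of_forall fun n =>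
      (HasOuterApproxClosed.measure_le_lintegral hF μ n).trans (h (hF.apprSeq n))
  refine Measure.le_iff.2 fun s hs => ?_
  rw [hs.measure_eq_iSup_isClosed_of_ne_top (measure_ne_top μ s)]
  exact iSup₂_le fun F hFs => iSup_le fun hF => (hclosed F hF).trans (measure_mono hFs)

namespace SubProb

theorem lintegral_eq_ofReal_pairing (ν : SubProb)
    (f : BoundedContinuousFunction UnitAddCircle ℝ≥0) :
    ∫⁻ u, f u ∂ν.toMeasure = ENNReal.ofReal (ν.pairing ⟨fun u => (f u : ℝ), by fun_prop⟩) := by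
  rw [pairing, ofReal_integral_eq_lintegral_ofReal (ν.integrable _) (.of_forall fun u => (f u).2)]
  simp only [ContinuousMap.coe_mk, ENNReal.ofReal_coe_nnreal]

/-- Lebesgue measure on the torus as an element of `𝓜`. -/
def lebesgue : SubProb :=
  ⟨⟨volume, inferInstance⟩, ENNReal.toNNReal_mono ENNReal.one_ne_top UnitAddCircle.measure_univ.le⟩

theorem toMeasure_le_volume {ν : SubProb}
    (h : ∀ f : C(UnitAddCircle, ℝ), 0 ≤ f → ν.pairing f ≤ ∫ u, f u) : ν.toMeasure ≤ volume :=
  measure_le_of_forall_lintegral_le fun f => by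
    rw [ν.lintegral_eq_ofReal_pairing]
    exact (ENNReal.ofReal_le_ofReal (h ⟨fun u => (f u : ℝ), by fun_prop⟩ fun u => (f u).2)).trans
      (lebesgue.lintegral_eq_ofReal_pairing f).ge

/-- Replacing `f` by `|f|` turns a dense sequence into a sequence that is dense in the nonnegative
functions. -/
theorem toMeasure_le_volume_of_denseSeq {ν : SubProb}
    (h : ∀ i, ν.pairing |TopologicalSpace.denseSeq C(UnitAddCircle, ℝ) i|
      ≤ ∫ u, |TopologicalSpace.denseSeq C(UnitAddCircle, ℝ) i| u) : ν.toMeasure ≤ volume := by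
  refine toMeasure_le_volume fun f hf => ?_
  have hcont (ν' : SubProb) : Continuous fun f : C(UnitAddCircle, ℝ) => ν'.pairing |f| :=
    continuous_pairing.comp (continuous_const.prodMk
      (ContinuousMap.continuous_postcomp ⟨_, continuous_abs⟩))
  have habs : ν.pairing |f| ≤ lebesgue.pairing |f| :=
    (TopologicalSpace.denseRange_denseSeq C(UnitAddCircle, ℝ)).induction_on f
      (isClosed_le (hcont ν) (hcont lebesgue)) h
  rwa [abs_of_nonneg hf] at habs

end SubProb

section Density

variable {T : ℝ}

theorem pairing_empirical_le {N : ℕ} [NeZero N] (η : Config N) {f : C(UnitAddCircle, ℝ)}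
    (hf : 0 ≤ f) :
    (empirical η).pairing f ≤ (1 / (N : ℝ)) * ∑ x : ZMod N, f (ZMod.toAddCircle x) := by
  rw [pairing_empirical]
  gcongr with x
  exact mul_le_of_le_one_right (hf _) (occ_mem_Icc η x).2

section LimitPoint

variable {P : ∀ N : ℕ+, Measure (ConfigPath N)}
  {Q : ℕ+ → ProbabilityMeasure (SkorohodSpace T SubProb)}
  {Q₀ : ProbabilityMeasure (SkorohodSpace T SubProb)}

theorem eventually_ae_pairing_le
    (hQ : ∀ N : ℕ+, HasLaw (empiricalPath N T) (Q N : Measure (SkorohodSpace T SubProb)) (P N))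
    {f : C(UnitAddCircle, ℝ)} (hf : 0 ≤ f) {ε : ℝ} (hε : 0 < ε) :
    ∀ᶠ N in atTop, ∀ᵐ π ∂(Q N : Measure (SkorohodSpace T SubProb)),
      ∀ t, (π.1 t).pairing f ≤ (∫ u, f u) + ε := by
  filter_upwards [(tendsto_riemannSum_unitAddCircle f).eventually_lt_const
    (lt_add_of_pos_right (∫ u, f u) hε)] with N hN
  rw [← (hQ N).map_eq]
  exact (ae_map_iff (hQ N).aemeasurable (isClosed_setOf_forall_pairing_le T f _).measurableSet).2
    (.of_forall fun ω t => (pairing_empirical_le _ hf).trans hN.le)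

theorem ae_pairing_le
    (hQ : ∀ N : ℕ+, HasLaw (empiricalPath N T) (Q N : Measure (SkorohodSpace T SubProb)) (P N))
    (hQ₀ : MapClusterPt Q₀ atTop Q) {f : C(UnitAddCircle, ℝ)} (hf : 0 ≤ f) :
    ∀ᵐ π ∂(Q₀ : Measure (SkorohodSpace T SubProb)), ∀ t, (π.1 t).pairing f ≤ ∫ u, f u := by
  have happrox (m : ℕ) : ∀ᵐ π ∂(Q₀ : Measure (SkorohodSpace T SubProb)),
      ∀ t, (π.1 t).pairing f ≤ (∫ u, f u) + 1 / ((m : ℝ) + 1) :=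
    ae_mem_of_mapClusterPt hQ₀ (isClosed_setOf_forall_pairing_le T f _)
      (eventually_ae_pairing_le hQ hf Nat.one_div_pos_of_nat)
  filter_upwards [ae_all_iff.2 happrox] with π hπ t
  refine le_of_forall_pos_le_add fun ε hε => ?_
  obtain ⟨m, hm⟩ := exists_nat_one_div_lt hε
  exact (hπ m t).trans (by gcongr)

theorem ae_toMeasure_le_volume
    (hQ : ∀ N : ℕ+, HasLaw (empiricalPath N T) (Q N : Measure (SkorohodSpace T SubProb)) (P N))
    (hQ₀ : MapClusterPt Q₀ atTop Q) :
    ∀ᵐ π ∂(Q₀ : Measure (SkorohodSpace T SubProb)), ∀ t, (π.1 t).toMeasure ≤ volume :=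
  (ae_all_iff.2 fun i => ae_pairing_le hQ hQ₀ (abs_nonneg (TopologicalSpace.denseSeq _ i))).mono
    fun _ hπ t => SubProb.toMeasure_le_volume_of_denseSeq fun i => hπ i t

end LimitPoint

theorem SkorohodSpace.measurable_toMeasure (hT : 0 < T) (π : SkorohodSpace T SubProb) :
    Measurable fun t => (π.1 t).toMeasure := by
  have hpairing (f : C(UnitAddCircle, ℝ)) : Measurable fun t => (π.1 t).pairing f :=
    measurable_of_continuousWithinAt_Ici hT fun t =>
      ((SubProb.uniformContinuous_pairing f).continuous.tendsto _).comp (π.2 t).1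
  have hclosed (F : Set UnitAddCircle) (hF : IsClosed F) :
      Measurable fun t => (π.1 t).toMeasure F := by
    refine measurable_of_tendsto_metrizable
      (f := fun n t => ∫⁻ u, hF.apprSeq n u ∂(π.1 t).toMeasure) (fun n => ?_)
      (tendsto_pi_nhds.2 fun t => HasOuterApproxClosed.tendsto_lintegral_apprSeq hF _)
    simpa only [SubProb.lintegral_eq_ofReal_pairing] using (hpairing _).ennreal_ofReal
  exact Measurable.measure_of_isPiSystem
    ((BorelSpace.measurable_eq (α := UnitAddCircle)).trans borel_eq_generateFrom_isClosed)
    isPiSystem_isClosed hclosed (hclosed univ isClosed_univ)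

/-- The Radon–Nikodym derivatives of the kernel `t ↦ π_t` are jointly measurable; truncating at `1`
makes the bound hold everywhere. -/
theorem exists_isDensity (hT : 0 < T) {π : SkorohodSpace T SubProb}
    (h : ∀ t, (π.1 t).toMeasure ≤ volume) : ∃ ρ : Cylinder T → ℝ, IsDensity π ρ := by
  let κ : Kernel (Icc (0 : ℝ) T) UnitAddCircle :=
    ⟨fun t => (π.1 t).toMeasure, π.measurable_toMeasure hT⟩
  have : IsFiniteKernel κ := ⟨1, ENNReal.one_lt_top, fun t => (π.1 t).measure_univ_le⟩
  let ν : Kernel (Icc (0 : ℝ) T) UnitAddCircle := Kernel.const _ volume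
  have hmeas := Kernel.measurable_rnDeriv κ ν
  have hdensity (t) : κ t = volume.withDensity (Kernel.rnDeriv κ ν t) :=
    (Kernel.withDensity_rnDeriv_eq (η := ν) (h t).absolutelyContinuous).symm.trans
      (Kernel.withDensity_apply _ hmeas t)
  refine ⟨fun p => (min 1 (Kernel.rnDeriv κ ν p.1 p.2)).toReal,
    (measurable_const.min hmeas).ennreal_toReal, fun p => ⟨ENNReal.toReal_nonneg, ?_⟩, fun t => ?_⟩
  · exact ENNReal.toReal_mono ENNReal.one_ne_top (min_le_left _ _)
  · refine (hdensity t).trans (withDensity_congr_ae ?_)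
    filter_upwards [Kernel.rnDeriv_eq_rnDeriv_measure (κ := κ) (η := ν) (a := t),
      Measure.rnDeriv_le_one_of_le (h t)] with u hrnDeriv hle
    have hle_one : Kernel.rnDeriv κ ν t u ≤ 1 := hrnDeriv.le.trans hle
    rw [min_eq_right hle_one, ENNReal.ofReal_toReal (hle_one.trans_lt ENNReal.one_lt_top).ne]

open Classical in
/-- A density of the path `π`, with the junk value `0` if there is none. -/
def density (π : SkorohodSpace T SubProb) : Cylinder T → ℝ :=
  if h : ∃ ρ, IsDensity π ρ then h.choose else 0

theorem isDensity_density (hT : 0 < T) {π : SkorohodSpace T SubProb}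
    (h : ∀ t, (π.1 t).toMeasure ≤ volume) : IsDensity π (density π) := by
  rw [density, dif_pos (exists_isDensity hT h)]
  exact (exists_isDensity hT h).choose_spec

namespace IsDensity

variable {π : SkorohodSpace T SubProb} {ρ : Cylinder T → ℝ}

theorem norm_le_one (h : IsDensity π ρ) (p : Cylinder T) : ‖ρ p‖ ≤ 1 :=
  (Real.norm_of_nonneg (h.2.1 p).1).trans_le (h.2.1 p).2

theorem memLp (h : IsDensity π ρ) : MemLp ρ 2 (cylinderMeasure T) :=
  .of_bound h.1.aestronglyMeasurable 1 (.of_forall h.norm_le_one)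

theorem pairing_eq (h : IsDensity π ρ) (t : Icc (0 : ℝ) T) (f : C(UnitAddCircle, ℝ)) :
    (π.1 t).pairing f = ∫ u, f u * ρ (t, u) := by
  simp only [SubProb.pairing, h.2.2 t]
  rw [integral_withDensity_eq_integral_toReal_smul (f := fun u => ENNReal.ofReal (ρ (t, u)))
    (h.1.comp measurable_prodMk_left).ennreal_ofReal (.of_forall fun _ => ENNReal.ofReal_lt_top)]
  simp only [ENNReal.toReal_ofReal (h.2.1 _).1, smul_eq_mul, mul_comm]

theorem timePairing_eq (h : IsDensity π ρ) (f : C(Cylinder T, ℝ)) :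
    timePairing f π = ∫ p, f p * ρ p ∂cylinderMeasure T := by
  have hint : Integrable (fun p => f p * ρ p) (cylinderMeasure T) :=
    (integrable_cylinder f.continuous).mul_bdd h.1.aestronglyMeasurable (.of_forall h.norm_le_one)
  rw [cylinderMeasure, integral_prod _ hint, timePairing]
  simp only [h.pairing_eq, ContinuousMap.curry_apply]

theorem energy_eq (h : IsDensity π ρ) (B : Set UnitAddCircle) :
    energy B ρ = pathEnergy B π :=
  iSup_congr fun φ => by rw [TorusTest.functional, h.timePairing_eq]; rfl

end IsDensity

end Density

/-! ### Weak derivatives from finite energy -/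

theorem exists_inner_eq_of_abs_le {V E : Type*} [AddCommGroup V] [Module ℝ V]
    [NormedAddCommGroup E] [InnerProductSpace ℝ E] [CompleteSpace E] (A : V →ₗ[ℝ] E)
    (l : V →ₗ[ℝ] ℝ) {K : ℝ} (h : ∀ v, |l v| ≤ K * ‖A v‖) :
    ∃ g : E, ∀ v, l v = inner ℝ g (A v) := by
  have hker : LinearMap.ker A ≤ LinearMap.ker l := fun v hv => by
    simpa [LinearMap.mem_ker.1 hv] using h v
  let m : LinearMap.range A →ₗ[ℝ] ℝ :=
    (LinearMap.ker A).liftQ l hker ∘ₗ A.quotKerEquivRange.symm.toLinearMap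
  have hm (v) : m ⟨A v, LinearMap.mem_range_self A v⟩ = l v := by
    simp only [m, LinearMap.comp_apply, LinearEquiv.coe_coe]
    rw [LinearMap.quotKerEquivRange_symm_apply_image A v]
    exact Submodule.liftQ_apply _ _ _
  obtain ⟨f, hf, -⟩ := exists_extension_norm_eq (LinearMap.range A)
    (m.mkContinuous K (by rintro ⟨_, v, rfl⟩; exact (congrArg norm (hm v)).trans_le (h v)))
  refine ⟨(InnerProductSpace.toDual ℝ E).symm f, fun v => ?_⟩
  rw [InnerProductSpace.toDual_symm_apply, ← hm v]
  exact (hf ⟨A v, LinearMap.mem_range_self A v⟩).symm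

/-- The bound at `x • v` is a quadratic inequality in `x`, whose discriminant is nonpositive. -/
theorem abs_le_sqrt_mul_norm_of_forall_sub_le {V E : Type*} [AddCommGroup V] [Module ℝ V]
    [NormedAddCommGroup E] [NormedSpace ℝ E] (A : V →ₗ[ℝ] E) (l : V →ₗ[ℝ] ℝ) {a C : ℝ}
    (h : ∀ v, l v - a * ‖A v‖ ^ 2 ≤ C) (v : V) : |l v| ≤ √(4 * a * C) * ‖A v‖ := by
  have hquadratic (x : ℝ) : 0 ≤ a * ‖A v‖ ^ 2 * (x * x) + -l v * x + C := by
    have := h (x • v)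
    rw [map_smul, map_smul, norm_smul, mul_pow, Real.norm_eq_abs, sq_abs, smul_eq_mul] at this
    linarith
  have hdiscrim := discrim_le_zero hquadratic
  rw [discrim] at hdiscrim
  rw [← Real.sqrt_sq (norm_nonneg (A v)), ← Real.sqrt_mul' _ (sq_nonneg _)]
  exact Real.abs_le_sqrt (by linarith)

section ToLp

variable {X : Type*} [TopologicalSpace X] [CompactSpace X] [MeasurableSpace X] [BorelSpace X]
  {μ : Measure X} [IsFiniteMeasure μ]

theorem inner_continuousMapToLp (f : Lp ℝ 2 μ) (h : C(X, ℝ)) :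
    inner ℝ f (ContinuousMap.toLp 2 μ ℝ h) = ∫ x, h x * f x ∂μ := by
  rw [L2.inner_def]
  refine integral_congr_ae ?_
  filter_upwards [ContinuousMap.coeFn_toLp (p := 2) (𝕜 := ℝ) μ h] with x hx
  rw [hx, RCLike.inner_apply, conj_trivial]

theorem norm_continuousMapToLp_sq (h : C(X, ℝ)) :
    ‖ContinuousMap.toLp 2 μ ℝ h‖ ^ 2 = ∫ x, h x ^ 2 ∂μ := by
  rw [← real_inner_self_eq_norm_sq, ContinuousMap.inner_toLp]
  simp only [conj_trivial, sq]

end ToLp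

section WeakDerivative

variable {T : ℝ} {B : Set UnitAddCircle}

/-- The space of pairs `(H, ∂_u H)` with `H` a test function. -/
def testPairs (T : ℝ) (B : Set UnitAddCircle) :
    Submodule ℝ (C(Cylinder T, ℝ) × C(Cylinder T, ℝ)) where
  carrier := range fun φ : TorusTest T B => (φ.toContinuousMap, φ.deriv)
  zero_mem' := ⟨0, rfl⟩
  add_mem' := by
    rintro _ _ ⟨φ, rfl⟩ ⟨ψ, rfl⟩
    exact ⟨{ H := φ.H + ψ.H
             dH := φ.dH + ψ.dH
             continuous_H := φ.continuous_H.add ψ.continuous_H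
             continuous_dH := φ.continuous_dH.add ψ.continuous_dH
             hasDerivAt := fun t u => (φ.hasDerivAt t u).add (ψ.hasDerivAt t u)
             support := (tsupport_add _ _).trans (union_subset φ.support ψ.support) }, rfl⟩
  smul_mem' := by
    rintro c _ ⟨φ, rfl⟩
    exact ⟨{ H := c • φ.H
             dH := c • φ.dH
             continuous_H := φ.continuous_H.const_smul c
             continuous_dH := φ.continuous_dH.const_smul c
             hasDerivAt := fun t u => (φ.hasDerivAt t u).const_smul c
             support := (closure_mono (Function.support_const_smul_subset c φ.H)).trans
              φ.support }, rfl⟩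

theorem TorusTest.sub_le_toReal_energy {ρ : Cylinder T → ℝ} (hE : energy B ρ ≠ ∞)
    (φ : TorusTest T B) :
    (∫ p, φ.dH p * ρ p ∂cylinderMeasure T) - 2 * ∫ p, φ.H p ^ 2 ∂cylinderMeasure T
      ≤ (energy B ρ).toReal :=
  (ENNReal.ofReal_le_iff_le_toReal hE).1 <| le_iSup (fun φ : TorusTest T B => ENNReal.ofReal
    ((∫ p, φ.dH p * ρ p ∂cylinderMeasure T) - 2 * ∫ p, φ.H p ^ 2 ∂cylinderMeasure T)) φ

theorem exists_isWeakDeriv_of_energy_ne_top {ρ : Cylinder T → ℝ}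
    (hρ : MemLp ρ 2 (cylinderMeasure T)) (hE : energy B ρ ≠ ∞) : ∃ g, IsWeakDeriv B ρ g := by
  let L : C(Cylinder T, ℝ) →ₗ[ℝ] Lp ℝ 2 (cylinderMeasure T) :=
    (ContinuousMap.toLp 2 (cylinderMeasure T) ℝ).toLinearMap
  let A : testPairs T B →ₗ[ℝ] Lp ℝ 2 (cylinderMeasure T) :=
    L ∘ₗ LinearMap.fst ℝ _ _ ∘ₗ (testPairs T B).subtype
  let l : testPairs T B →ₗ[ℝ] ℝ :=
    (innerₛₗ ℝ (hρ.toLp ρ)) ∘ₗ L ∘ₗ LinearMap.snd ℝ _ _ ∘ₗ (testPairs T B).subtype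
  have hl (φ : TorusTest T B) : l ⟨(φ.toContinuousMap, φ.deriv), φ, rfl⟩
      = ∫ p, φ.dH p * ρ p ∂cylinderMeasure T := by
    refine (inner_continuousMapToLp (hρ.toLp ρ) φ.deriv).trans (integral_congr_ae ?_)
    filter_upwards [hρ.coeFn_toLp] with p hp
    rw [hp]
    rfl
  have hbound (v : testPairs T B) : l v - 2 * ‖A v‖ ^ 2 ≤ (energy B ρ).toReal := by
    obtain ⟨_, φ, rfl⟩ := v
    rw [hl φ]
    exact (congrArg _ (congrArg _ (norm_continuousMapToLp_sq φ.toContinuousMap))).trans_le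
      (φ.sub_le_toReal_energy hE)
  obtain ⟨g, hg⟩ := exists_inner_eq_of_abs_le A l
    (abs_le_sqrt_mul_norm_of_forall_sub_le A l hbound)
  refine ⟨-g, (Lp.memLp g).neg, fun φ => ?_⟩
  rw [← hl φ, hg, ← integral_neg]
  refine (inner_continuousMapToLp g φ.toContinuousMap).trans (integral_congr_ae ?_)
  exact .of_forall fun p => by simp only [Pi.neg_apply, mul_neg, neg_neg]; rfl

end WeakDerivative

/-! ### Periodization of functions on an interval -/

section Periodize

variable {X : Type*} {a : ℝ}

/-- The function on `X × 𝕋` that agrees with `F` on `X × [a, a+1)`. -/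
def periodize (a : ℝ) (F : X × ℝ → ℝ) (p : X × UnitAddCircle) : ℝ :=
  F (p.1, (AddCircle.equivIco 1 a p.2 : ℝ))

theorem periodize_coe_of_mem_Ico (F : X × ℝ → ℝ) (x : X) {u : ℝ} (hu : u ∈ Ico a (a + 1)) :
    periodize a F (x, (u : UnitAddCircle)) = F (x, u) := by
  rw [periodize, AddCircle.equivIco_coe_of_mem hu]

theorem periodize_coe_sub_intCast (F : X × ℝ → ℝ) (x : X) (n : ℤ) (v : ℝ) :
    periodize a F (x, ((v - n : ℝ) : UnitAddCircle)) = periodize a F (x, (v : UnitAddCircle)) := by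
  congr 2
  rw [AddCircle.coe_sub, sub_eq_self]
  exact (AddCircle.coe_eq_zero_iff (1 : ℝ)).2 ⟨n, by simp only [zsmul_eq_mul, mul_one]⟩

/-- Near every point of the line, `periodize a F` is a sum of two translates of `F`. This reduces
its regularity to that of `F`. -/
theorem periodize_coe {F : X × ℝ → ℝ} (hF : ∀ x, ∀ u ∉ Ioo a (a + 1), F (x, u) = 0) (x : X) (n : ℤ)
    {v : ℝ} (hv : v - n ∈ Ioo (a - 1) (a + 1)) :
    periodize a F (x, (v : UnitAddCircle)) = F (x, v - n) + F (x, v - n + 1) := by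
  obtain ⟨hlt, hgt⟩ := hv
  rcases le_or_gt a (v - n) with h | h
  · rw [← periodize_coe_sub_intCast F x n, periodize_coe_of_mem_Ico F x ⟨h, hgt⟩,
      hF x (v - n + 1) fun h' => by linarith [h'.2], add_zero]
  · have hshift : v - ((n - 1 : ℤ) : ℝ) = v - n + 1 := by push_cast; ring
    rw [← periodize_coe_sub_intCast F x (n - 1), hshift,
      periodize_coe_of_mem_Ico F x ⟨by linarith, by linarith⟩,
      hF x (v - n) fun h' => by linarith [h'.1], zero_add]

theorem exists_int_eventually_sub_mem_Ioo (a u : ℝ) :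
    ∃ n : ℤ, ∀ᶠ v : ℝ in 𝓝 u, v - (n : ℝ) ∈ Ioo (a - 1) (a + 1) :=
  ⟨⌊u - a⌋, (continuous_sub_right _).continuousAt.eventually_mem
    (Ioo_mem_nhds (by linarith [Int.floor_le (u - a)])
      (by linarith [Int.lt_floor_add_one (u - a)]))⟩

theorem hasDerivAt_periodize {F F' : X × ℝ → ℝ} (hF : ∀ x, ∀ u ∉ Ioo a (a + 1), F (x, u) = 0)
    (hF' : ∀ x, ∀ u ∉ Ioo a (a + 1), F' (x, u) = 0)
    (h : ∀ x u, HasDerivAt (fun v => F (x, v)) (F' (x, u)) u) (x : X) (u : ℝ) :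
    HasDerivAt (fun v : ℝ => periodize a F (x, (v : UnitAddCircle)))
      (periodize a F' (x, (u : UnitAddCircle))) u := by
  obtain ⟨n, hn⟩ := exists_int_eventually_sub_mem_Ioo a u
  rw [periodize_coe hF' x n hn.self_of_nhds]
  refine HasDerivAt.congr_of_eventuallyEq ?_ (hn.mono fun v hv => periodize_coe hF x n hv)
  exact ((h x (u - n)).comp_sub_const u n).add
    (((h x (u - n + 1)).comp_add_const (u - n) 1).comp_sub_const u n)

variable [TopologicalSpace X]

theorem isQuotientMap_prodMap_coe : IsQuotientMap
    (Prod.map id (fun u : ℝ => (u : UnitAddCircle)) : X × ℝ → X × UnitAddCircle) :=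
  (IsOpenQuotientMap.id.prodMap QuotientAddGroup.isOpenQuotientMap_mk).isQuotientMap

theorem continuous_periodize {F : X × ℝ → ℝ} (hF : ∀ x, ∀ u ∉ Ioo a (a + 1), F (x, u) = 0)
    (hcont : Continuous F) : Continuous (periodize a F) := by
  rw [isQuotientMap_prodMap_coe.continuous_iff, continuous_iff_continuousAt]
  rintro ⟨x, u⟩
  obtain ⟨n, hn⟩ := exists_int_eventually_sub_mem_Ioo a u
  have hsum : Continuous fun p : X × ℝ => F (p.1, p.2 - n) + F (p.1, p.2 - n + 1) := by fun_prop
  exact hsum.continuousAt.congr ((continuous_snd.tendsto (x, u)).eventually hn |>.mono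
    fun p hp => (periodize_coe hF p.1 n hp).symm)

theorem tsupport_periodize_subset [T2Space X] {F : X × ℝ → ℝ} (hF : HasCompactSupport F) :
    tsupport (periodize a F)
      ⊆ Prod.map id (fun u : ℝ => (u : UnitAddCircle)) '' tsupport F :=
  closure_minimal
    (fun p hp => ⟨(p.1, (AddCircle.equivIco 1 a p.2 : ℝ)), subset_tsupport F hp,
      Prod.ext rfl AddCircle.coe_equivIco⟩)
    (hF.isCompact.image isQuotientMap_prodMap_coe.continuous).isClosed

end Periodize

theorem integral_prod_restrict_eq_of_forall_notMem {X Y : Type*} [MeasurableSpace X]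
    [MeasurableSpace Y] (τ : Measure X) (ν : Measure Y) [SFinite τ] [SFinite ν] {G : X × Y → ℝ}
    {A s : Set Y} (hG : ∀ x, ∀ y ∉ A, G (x, y) = 0) (hAs : A ⊆ s) :
    ∫ p, G p ∂τ.prod (ν.restrict s) = ∫ p, G p ∂τ.prod ν := by
  rw [← τ.restrict_univ, Measure.prod_restrict, τ.restrict_univ]
  exact setIntegral_eq_integral_of_forall_compl_eq_zero fun p hp =>
    hG p.1 p.2 fun hpA => hp ⟨mem_univ _, hAs hpA⟩

section Strip

variable {T a c : ℝ}

theorem measurePreserving_prodMap_coe (T a : ℝ) :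
    MeasurePreserving (Prod.map id fun u : ℝ => (u : UnitAddCircle))
      ((timeMeasure T).prod (volume.restrict (Ico a (a + 1)))) (cylinderMeasure T) := by
  rw [Measure.restrict_congr_set (Ico_ae_eq_Ioc (μ := volume))]
  exact (MeasurePreserving.id _).prod (UnitAddCircle.measurePreserving_mk a)

theorem memLp_strip {f : Cylinder T → ℝ} (hf : MemLp f 2 (cylinderMeasure T)) (hca : c ≤ a + 1) :
    MemLp (fun p : Icc (0 : ℝ) T × ℝ => f (p.1, (p.2 : UnitAddCircle))) 2 (stripMeasure T a c) := by
  refine (hf.comp_measurePreserving (measurePreserving_prodMap_coe T a)).mono_measure ?_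
  rw [stripMeasure, ← Measure.restrict_congr_set (Ico_ae_eq_Icc (μ := volume))]
  exact Measure.prod_mono le_rfl (Measure.restrict_mono (Ico_subset_Ico_right hca) le_rfl)

theorem integral_periodize_mul {F : Icc (0 : ℝ) T × ℝ → ℝ}
    (hF : ∀ t, ∀ u ∉ Ioo a (a + 1), F (t, u) = 0) (hcont : Continuous F) {h : Cylinder T → ℝ}
    (hh : AEStronglyMeasurable h (cylinderMeasure T)) :
    ∫ p, periodize a F p * h p ∂cylinderMeasure T
      = ∫ p, F p * h (p.1, (p.2 : UnitAddCircle))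
          ∂(timeMeasure T).prod (volume.restrict (Ico a (a + 1))) := by
  have hmp := measurePreserving_prodMap_coe T a
  rw [← hmp.map_eq, integral_map hmp.aemeasurable
    (hmp.map_eq ▸ (continuous_periodize hF hcont).aestronglyMeasurable.mul hh)]
  have hsnd : ∀ᵐ p ∂(timeMeasure T).prod (volume.restrict (Ico a (a + 1))), p.2 ∈ Ico a (a + 1) :=
    Measure.quasiMeasurePreserving_snd.ae (ae_restrict_mem measurableSet_Ico)
  refine integral_congr_ae (hsnd.mono fun p hp => ?_)
  simp only [Prod.map, id, periodize_coe_of_mem_Ico F p.1 hp]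

theorem integral_strip_eq {F : Icc (0 : ℝ) T × ℝ → ℝ} (hca : c ≤ a + 1)
    (hF : ∀ t, ∀ u ∉ Ioo a c, F (t, u) = 0) (hcont : Continuous F) {h : Cylinder T → ℝ}
    (hh : AEStronglyMeasurable h (cylinderMeasure T)) :
    ∫ p, F p * h (p.1, (p.2 : UnitAddCircle)) ∂stripMeasure T a c
      = ∫ p, periodize a F p * h p ∂cylinderMeasure T := by
  have hIoo : Ioo a c ⊆ Ioo a (a + 1) := Ioo_subset_Ioo_right hca
  have hFh (t) (u) (hu : u ∉ Ioo a c) : F (t, u) * h (t, (u : UnitAddCircle)) = 0 := by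
    rw [hF t u hu, zero_mul]
  rw [integral_periodize_mul (fun t u hu => hF t u fun hu' => hu (hIoo hu')) hcont hh, stripMeasure,
    integral_prod_restrict_eq_of_forall_notMem _ _ hFh Ioo_subset_Icc_self,
    integral_prod_restrict_eq_of_forall_notMem _ _ hFh (hIoo.trans Ioo_subset_Ico_self)]

namespace IntervalTest

theorem H_eq_zero (φ : IntervalTest T a c) (t : Icc (0 : ℝ) T) {u : ℝ} (hu : u ∉ Ioo a c) :
    φ.H (t, u) = 0 :=
  image_eq_zero_of_notMem_tsupport fun h => hu (φ.support h).2

theorem dH_eq_zero (φ : IntervalTest T a c) (t : Icc (0 : ℝ) T) {u : ℝ} (hu : u ∉ Ioo a c) :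
    φ.dH (t, u) = 0 := by
  have hH : φ.H =ᶠ[𝓝 (t, u)] 0 :=
    notMem_tsupport_iff_eventuallyEq.1 fun h => hu (φ.support h).2
  have hslice : (fun v : ℝ => φ.H (t, v)) =ᶠ[𝓝 u] fun _ => 0 :=
    (Continuous.prodMk_right t).continuousAt.eventually hH
  exact (φ.hasDerivAt t u).unique ((hasDerivAt_const u (0 : ℝ)).congr_of_eventuallyEq hslice)

/-- The periodization of a test function on an interval, as a test function on the torus. -/
def toTorusTest (φ : IntervalTest T a c) (hca : c ≤ a + 1) {B : Set UnitAddCircle}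
    (hB : ∀ u ∈ Ioo a c, (u : UnitAddCircle) ∉ B) : TorusTest T B where
  H := periodize a φ.H
  dH := periodize a φ.dH
  continuous_H := continuous_periodize
    (fun t _ hu => φ.H_eq_zero t fun hu' => hu (Ioo_subset_Ioo_right hca hu')) φ.continuous_H
  continuous_dH := continuous_periodize
    (fun t _ hu => φ.dH_eq_zero t fun hu' => hu (Ioo_subset_Ioo_right hca hu')) φ.continuous_dH
  hasDerivAt := hasDerivAt_periodize
    (fun t _ hu => φ.H_eq_zero t fun hu' => hu (Ioo_subset_Ioo_right hca hu'))
    (fun t _ hu => φ.dH_eq_zero t fun hu' => hu (Ioo_subset_Ioo_right hca hu')) φ.hasDerivAt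
  support := (tsupport_periodize_subset φ.compactSupport).trans <| by
    rintro _ ⟨p, hp, rfl⟩
    exact ⟨mem_univ _, hB _ (φ.support hp).2⟩

end IntervalTest

theorem IsWeakDeriv.memL2H1 {B : Set UnitAddCircle} {ρ g : Cylinder T → ℝ}
    (hg : IsWeakDeriv B ρ g) (hρ : MemLp ρ 2 (cylinderMeasure T)) (hca : c ≤ a + 1)
    (hB : ∀ u ∈ Ioo a c, (u : UnitAddCircle) ∉ B) :
    MemL2H1 T a c fun p => ρ (p.1, (p.2 : UnitAddCircle)) := by
  refine ⟨memLp_strip hρ hca, _, memLp_strip hg.1 hca, fun φ => ?_⟩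
  rw [integral_strip_eq hca (fun t _ => φ.dH_eq_zero t) φ.continuous_dH hρ.1,
    integral_strip_eq hca (fun t _ => φ.H_eq_zero t) φ.continuous_H hg.1.1]
  exact hg.2 (φ.toTorusTest hca hB)

end Strip

section NextPoint

variable {k : ℕ} {b : Fin k → ℝ}

theorem nextPoint_le_of_lt (hb : StrictMono b) {i j : Fin k} (hij : i < j) :
    nextPoint b i ≤ b j := by
  have hsucc : (i : ℕ) + 1 ≤ j := hij
  rw [nextPoint, dif_pos (hsucc.trans_lt j.2)]
  exact hb.monotone (Fin.mk_le_of_le_val hsucc)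

theorem nextPoint_le_add_one (hb : StrictMono b) (hb01 : ∀ i, b i ∈ Ico (0 : ℝ) 1) (i j : Fin k) :
    nextPoint b i ≤ b j + 1 := by
  unfold nextPoint
  split_ifs with hi
  · linarith [(hb01 ⟨i + 1, hi⟩).2, (hb01 j).1]
  · linarith [hb.monotone (Fin.mk_le_of_le_val (Nat.zero_le _) : (⟨0, i.pos⟩ : Fin k) ≤ j)]

theorem coe_notMem_slowPoints (hb : StrictMono b) (hb01 : ∀ i, b i ∈ Ico (0 : ℝ) 1) (i : Fin k)
    {u : ℝ} (hu : u ∈ Ioo (b i) (nextPoint b i)) : (u : UnitAddCircle) ∉ slowPoints b := by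
  rintro ⟨j, hj⟩
  obtain ⟨m, hm⟩ := (AddCircle.coe_eq_zero_iff (1 : ℝ)).1
    (show ((u - b j : ℝ) : UnitAddCircle) = 0 by rw [AddCircle.coe_sub, sub_eq_zero]; exact hj.symm)
  rw [zsmul_eq_mul, mul_one] at hm
  rcases lt_or_ge i j with hij | hji
  · have hneg : (m : ℝ) < 0 := by linarith [hu.2, nextPoint_le_of_lt hb hij]
    have hgt : (-1 : ℝ) < m := by linarith [hu.1, (hb01 i).1, (hb01 j).2]
    norm_cast at hneg hgt
    omega
  · have hpos : (0 : ℝ) < m := by linarith [hu.1, hb.monotone hji]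
    have hlt : (m : ℝ) < 1 := by linarith [hu.2, nextPoint_le_add_one hb hb01 i j]
    norm_cast at hpos hlt
    omega

end NextPoint

theorem tendsto_atTop_of_strictMono_pnat {n : ℕ → ℕ+} (hn : StrictMono n) :
    Tendsto n atTop atTop := by
  refine tendsto_atTop.2 fun m => (eventually_ge_atTop (m : ℕ)).mono fun j hj => ?_
  exact (PNat.coe_le_coe _ _).1 (hj.trans (StrictMono.le_apply (f := fun j => (n j : ℕ)) hn))

end

end SlowBond

open SlowBond in
theorem mainTheorem3_general (β : ℝ) {T : ℝ} (hT : 0 < T) {k : ℕ} {b : Fin k → ℝ}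
    (hb : StrictMono b) (hb01 : ∀ i, b i ∈ Ico (0 : ℝ) 1)
    {μ : ∀ N : ℕ+, Measure (Config N)} (hμ : ∀ N, IsProbabilityMeasure (μ N))
    {P : ∀ N : ℕ+, Measure (ConfigPath N)} (hP : ∀ N : ℕ+, IsExclusionLaw β b N (μ N) (P N))
    {Q : ℕ+ → ProbabilityMeasure (SkorohodSpace T SubProb)}
    (hQ : ∀ N : ℕ+, HasLaw (empiricalPath N T) (Q N : Measure (SkorohodSpace T SubProb)) (P N))
    {Q₀ : ProbabilityMeasure (SkorohodSpace T SubProb)} (hQ₀ : MapClusterPt Q₀ atTop Q) :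
    ∃ ρ : SkorohodSpace T SubProb → Cylinder T → ℝ,
      (∀ᵐ π ∂(Q₀ : Measure (SkorohodSpace T SubProb)),
        IsDensity π (ρ π) ∧ (∃ g, IsWeakDeriv (slowPoints b) (ρ π) g) ∧
        ∀ i, MemL2H1 T (b i) (nextPoint b i) fun p => ρ π (p.1, (p.2 : UnitAddCircle))) ∧
      AEMeasurable (fun π => energy (slowPoints b) (ρ π))
        (Q₀ : Measure (SkorohodSpace T SubProb)) ∧
      ∀ α ∈ Ioo (0 : ℝ) 1, (∃ K₀, IsEntropyConstant α K₀) ∧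
        ∀ K₀, IsEntropyConstant α K₀ →
          ∫⁻ π, energy (slowPoints b) (ρ π) ∂(Q₀ : Measure (SkorohodSpace T SubProb))
            ≤ ENNReal.ofReal K₀ := by
  have hE := lintegral_pathEnergy_le hT hP hQ hQ₀
  have hfinite := ae_lt_top (measurable_pathEnergy hT) (hE.trans_lt ENNReal.ofReal_lt_top).ne
  have hdensity := (ae_toMeasure_le_volume hQ hQ₀).mono fun _ => isDensity_density hT
  have henergy := hdensity.mono fun _ h => h.energy_eq (slowPoints b)
  refine ⟨density, ?_, ⟨_, measurable_pathEnergy hT, henergy⟩, fun α hα =>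
    ⟨exists_isEntropyConstant hα, fun K₀ hK => ?_⟩⟩
  · filter_upwards [hdensity, hfinite, henergy] with π hπ hπfinite hπenergy
    obtain ⟨g, hg⟩ := exists_isWeakDeriv_of_energy_ne_top hπ.memLp (hπenergy ▸ hπfinite.ne)
    exact ⟨hπ, ⟨g, hg⟩, fun i => hg.memL2H1 hπ.memLp (nextPoint_le_add_one hb hb01 i i)
      fun u hu => coe_notMem_slowPoints hb hb01 i hu⟩
  · exact (lintegral_congr_ae henergy).trans_le
      (hE.trans (ENNReal.ofReal_le_ofReal (hK.log_two_le hα)))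

theorem mainTheorem3 (β : ℝ) (hβ : 1 < β) (T : ℝ) (hT : 0 < T)
    (k : ℕ) (b : Fin k → ℝ) (hb : StrictMono b) (hb01 : ∀ i, b i ∈ Set.Ico (0 : ℝ) 1)
    (γ : UnitAddCircle → ℝ) (hγ : Continuous γ) (hγ01 : ∀ u, γ u ∈ Set.Icc (0 : ℝ) 1)
    (μ : ∀ N : ℕ+, Measure (SlowBond.Config N)) (hμ : ∀ N, IsProbabilityMeasure (μ N))
    (hμγ : SlowBond.IsAssociated μ γ)
    (P : ∀ N : ℕ+, Measure (SlowBond.ConfigPath N))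
    (hP : ∀ N : ℕ+, SlowBond.IsExclusionLaw β b N (μ N) (P N))
    (Q : ℕ+ → ProbabilityMeasure (SlowBond.SkorohodSpace T SlowBond.SubProb))
    (hQ : ∀ N : ℕ+, HasLaw (SlowBond.empiricalPath N T)
      (Q N : Measure (SlowBond.SkorohodSpace T SlowBond.SubProb)) (P N))
    (Qs : ProbabilityMeasure (SlowBond.SkorohodSpace T SlowBond.SubProb))
    (hQs : ∃ n : ℕ → ℕ+, StrictMono n ∧ Tendsto (fun j => Q (n j)) atTop (𝓝 Qs)) :
    ∃ ρ : SlowBond.SkorohodSpace T SlowBond.SubProb → SlowBond.Cylinder T → ℝ,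
      (∀ᵐ π ∂(Qs : Measure (SlowBond.SkorohodSpace T SlowBond.SubProb)),
        SlowBond.IsDensity π (ρ π) ∧
        (∃ g, SlowBond.IsWeakDeriv (SlowBond.slowPoints b) (ρ π) g) ∧
        ∀ i, SlowBond.MemL2H1 T (b i) (SlowBond.nextPoint b i)
          (fun p => ρ π (p.1, (p.2 : UnitAddCircle)))) ∧
      AEMeasurable (fun π => SlowBond.energy (SlowBond.slowPoints b) (ρ π))
        (Qs : Measure (SlowBond.SkorohodSpace T SlowBond.SubProb)) ∧
      ∀ α ∈ Set.Ioo (0 : ℝ) 1,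
        (∃ K₀, SlowBond.IsEntropyConstant α K₀) ∧
        ∀ K₀, SlowBond.IsEntropyConstant α K₀ →
          ∫⁻ π, SlowBond.energy (SlowBond.slowPoints b) (ρ π)
            ∂(Qs : Measure (SlowBond.SkorohodSpace T SlowBond.SubProb)) ≤ ENNReal.ofReal K₀ := by
  obtain ⟨n, hn, hlim⟩ := hQs
  exact mainTheorem3_general β hT hb hb01 hμ hP hQ
    (hlim.mapClusterPt.of_comp (SlowBond.tendsto_atTop_of_strictMono_pnat hn))
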